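/- For positive integers $k$, $m$ and $r,s\in\{1,\dots,k\}$ let $\mathcal A_m^{(k)}(r\to s)$ be the set of alternating sequences $a_1\le a_2\ge a_3\le a_4\ge\cdots$ of length $m$, all of whose entries are integers between $1$ and $k$, with $a_1=r$ and $a_m=s$. For integers $n,k\ge 0$ let $a(n,k)$ be the number of paths with $n$ steps $(1,1)$ or $(1,-1)$ that start at $(0,0)$, end anywhere, and pass neither below the $x$-axis nor above the line $y=k$. By the extension of a sequence $(u_n)_{n\ge N}$ of rational numbers to all integer indices we mean the unique sequence $(u_n)_{n\in\mathbb Z}$ of rational numbers that agrees with it for $n\ge N$ and satisfies, at all integer indices, a homogeneous linear recurrence with constant coefficients, with non-zero leading and trailing coefficients. (A) Let $n\ge 0$ and $1\le r,s\le k$ be integers. Then $$\det\Bigl(\bigl|\mathcal A^{(k)}_{2n+2i+2j+1}(r\to s)\bigr|\Bigr)_{0\le i,j\le k-1}=\begin{cases}0,&\text{if }\gcd(2r-1,2k+1)\ne1\text{ or }\gcd(2s-1,2k+1)\ne1,\\(-1)^{k(r+s)+\sum_{i=1}^k\left(\left\lfloor\frac{i(2r-1)}{2k+1}\right\rfloor+\left\lfloor\frac{i(2s-1)}{2k+1}\right\rfloor\right)},&\text{if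 }\gcd(2r-1,2k+1)=\gcd(2s-1,2k+1)=1,\end{cases}$$ and $$\det\Bigl(\bigl|\mathcal A^{(k)}_{2n+2i+2j}(r\to s)\bigr|\Bigr)_{0\le i,j\le k-1}=\begin{cases}0,&\text{if }\gcd(2r-1,2k+1)\ne1\text{ or }\gcd(2s,2k+1)\ne1,\\(-1)^{k(r+s)+\sum_{i=1}^k\left(\left\lfloor\frac{i(2r-1)}{2k+1}\right\rfloor+\left\lfloor\frac{2is}{2k+1}\right\rfloor\right)},&\text{if }\gcd(2r-1,2k+1)=\gcd(2s,2k+1)=1.\end{cases}$$ In the second identity with $n=0$, the symbol $|\mathcal A_0^{(k)}(r\to s)|$ stands for the value at $m=0$ of the extension, which exists, of the sequence $\bigl(|\mathcal A_{2m}^{(k)}(r\to s)|\bigr)_{m\ge1}$ to all integers $m$. (B) Let $k\ge1$ be an integer, and put $\tilde a(n,4k)=a(n,4k)$ for $n\ge1$ and $\tilde a(0,4k)=\frac{2k}{2k+1}$. The sequences $(\tilde a(n,4k))_{n\ge0}$ and $(a(n,4k-2))_{n\ge0}$ have extensions to all integer indices $n$, and for these and all integers $n\ge0$ we have $$\det\bigl(\tilde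 a(-n-i-j-1,4k)\bigr)_{0\le i,j\le 2k-1}=(-1)^{k(n-1)}(2k+1)^{-n-4k}$$ and $$\det\bigl(a(-n-i-j,4k-2)\bigr)_{0\le i,j\le 2k-1}=(-1)^{kn}2^{-n-4k+2}.$$ -/

import Mathlib

/-- The set `𝒜_n^{(k)}(r → s)` of alternating sequences `a₁ ≤ a₂ ≥ a₃ ≤ a₄ ≥ ⋯` of length `n`
with all entries integers between `1` and `k`, with first entry `r` and last entry `s`.
The entry `a_{i+1}` of the usual 1-based indexing is `a i` here. -/
def altSeqs (k n r s : ℕ) : Set (Fin n → ℕ) :=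
  {a | (∀ i, 1 ≤ a i ∧ a i ≤ k) ∧
    (∀ (i : ℕ) (hi : i + 1 < n),
      if Even i then a ⟨i, by omega⟩ ≤ a ⟨i + 1, hi⟩ else a ⟨i + 1, hi⟩ ≤ a ⟨i, by omega⟩) ∧
    ∃ hn : 0 < n, a ⟨0, hn⟩ = r ∧ a ⟨n - 1, by omega⟩ = s}

/-- The number `|𝒜_n^{(k)}(r → s)|`. -/
noncomputable def altNum (k n r s : ℕ) : ℕ := (altSeqs k n r s).ncard

/-- Up-down paths (steps `(1,1)` and `(1,-1)`) from `(0,r)` to `(n,s)` that pass neither below the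
`x`-axis nor above the line `y = k`, given by their sequence of heights. -/
def upDownPaths (k n r s : ℕ) : Set (Fin (n + 1) → ℕ) :=
  {h | h 0 = r ∧ h (Fin.last n) = s ∧ (∀ i, h i ≤ k) ∧
    ∀ i : Fin n, h i.succ = h i.castSucc + 1 ∨ h i.castSucc = h i.succ + 1}

/-- The number `C_n^{(k)}(r → s)` of bounded up-down paths. -/
noncomputable def pathNum (k n r s : ℕ) : ℕ := (upDownPaths k n r s).ncard

/-- `a(n,k) = ∑_{s=0}^{k} C_n^{(k)}(0 → s)`. -/
noncomputable def pathSum (n k : ℕ) : ℕ := ∑ s ∈ Finset.range (k + 1), pathNum k n 0 s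

/-- The modified sequence: `ã(n,4k) = a(n,4k)` for `n ≥ 1` and `ã(0,4k) = 2k/(2k+1)`. -/
noncomputable def pathSumMod (k n : ℕ) : ℚ :=
  if n = 0 then 2 * (k : ℚ) / (2 * (k : ℚ) + 1) else (pathSum n (4 * k) : ℚ)

/-- `b` is an extension of the sequence `(u n)_{n ≥ 0}` to all integer indices by means of a
homogeneous linear recurrence with constant coefficients (with non-zero extreme coefficients). -/
def IsRecurrenceExtension (u : ℕ → ℚ) (b : ℤ → ℚ) : Prop :=
  (∀ n : ℕ, b n = u n) ∧
    ∃ (d : ℕ) (c : ℕ → ℚ), c 0 ≠ 0 ∧ c d ≠ 0 ∧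
      ∀ m : ℤ, ∑ i ∈ Finset.range (d + 1), c i * b (m + i) = 0

/-! Alternating sequences. Let `L` be the upper triangular all-ones matrix and `S = L Lᵀ`. Two
consecutive steps of a sequence amount to one factor `S`, so the counts for odd length are entries
of `S ^ m`, and those for even length are entries of `S ^ m * L = S ^ (m+1) * (L⁻¹)ᵀ`. The last form
also makes sense one step before the first count, which gives the value at length zero. After
reversal of rows and columns, a Hankel matrix of numbers `uᵀ S ^ (m+i+j) v` factors through the
Krylov matrices of `u` and `v` for `T = S⁻¹`. As `det S = 1`, its determinant is the product of the
two Krylov determinants and does not depend on `m` (`det_hankel_stepMatrix`).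

If the rows of `W` are eigenvectors of `T`, then `det W` times the Krylov determinant of `v` is a
fixed Vandermonde determinant times the product of the coordinates of `W v` (`det_krylov_mul`). The
eigenvectors here are sampled sines at the angles `iπ/(2k+1)`. Comparison with the first unit
vector, whose Krylov matrix is triangular with diagonal entries `±1`, leaves the quotient of `∏ sin
(c i π/(2k+1))` and `∏ sin (i π/(2k+1))`. As in Gauss's lemma, multiplication by a `c` coprime to
`2k+1` permutes the residues up to sign, so the quotient is a sign given by the floors; otherwise
some factor vanishes (`prod_sin_mul_oddAngle`).

Paths at negative indices. In the strip of height `2q-2` the count is `∑ w_l x_l ^ n`, where the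
nodes `x_l = 2 cos ψ_l` are the roots of the rescaled Chebyshev polynomial `C_q` and `w_l = (1 + cos
ψ_l)/q` (`pathSum_eq`). The extension is the same sum at negative exponents, and its Hankel
determinant is `∏ w_l`, times a power of `∏ x_l`, times a squared Vandermonde determinant
(`det_hankel_exponential_sum`). Up to sign that square is `∏ C_q'(x_l)`, which nearly cancels the
weights because `∏ (1 + cos ψ_l) = ∏ sin ψ_l`. For odd `q` one node is zero; dropping it is what
forces the modified initial value. -/

/-! ### Transfer recursion for alternating sequences. -/

theorem altSeqs_finite (k n r s : ℕ) : (altSeqs k n r s).Finite := by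
  refine (Set.Finite.pi' (fun _ : Fin n => Set.finite_Icc 1 k)).subset ?_
  rintro a ⟨h, -⟩ i
  exact h i

theorem altNum_one (k r s : ℕ) (hr : 1 ≤ r) (hrk : r ≤ k) :
    altNum k 1 r s = if r = s then 1 else 0 := by
  unfold altNum
  split_ifs with h
  · subst h
    rw [Set.ncard_eq_one]
    refine ⟨fun _ => r, ?_⟩
    ext a
    constructor
    · rintro ⟨-, -, hn, h0, -⟩
      funext i
      rw [Subsingleton.elim i ⟨0, hn⟩, h0]
    · rintro rfl
      exact ⟨fun _ => ⟨hr, hrk⟩, fun i hi => by omega, one_pos, rfl, rfl⟩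
  · rw [Set.ncard_eq_zero (altSeqs_finite k 1 r s), Set.eq_empty_iff_forall_notMem]
    rintro a ⟨-, -, hn, h0, h1⟩
    exact h (h0.symm.trans h1)

/-- Once the penultimate entry is fixed, the last comparison concerns only `t` and `s`. Its
direction depends on the parity of `n`, the zero-based index of the penultimate entry. -/
theorem altSeqs_fiber (k n r s t : ℕ) (hs : 1 ≤ s) (hsk : s ≤ k)
    (hts : if Even n then t ≤ s else s ≤ t) :
    {a ∈ altSeqs k (n + 2) r s | a (Fin.last n).castSucc = t} =
      (fun a : Fin (n + 1) → ℕ => (Fin.snoc a s : Fin (n + 2) → ℕ)) '' altSeqs k (n + 1) r t := by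
  ext a
  constructor
  · rintro ⟨⟨hb, hm, hn, h0, h1⟩, ht⟩
    have hlast : a (Fin.last (n + 1)) = s := h1
    refine ⟨Fin.init a, ⟨fun i => hb _, fun i hi => ?_, Nat.succ_pos _, h0, ht⟩, ?_⟩
    · exact hm i (by omega)
    · simp only
      rw [← hlast]
      exact Fin.snoc_init_self a
  · rintro ⟨b, ⟨hb, hm, hn, h0, h1⟩, rfl⟩
    have hlast : b (Fin.last n) = t := h1
    refine ⟨⟨fun i => ?_, fun i hi => ?_, Nat.succ_pos _, ?_, ?_⟩, ?_⟩
    · induction i using Fin.lastCases with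
      | last => simpa using ⟨hs, hsk⟩
      | cast i => simpa using hb i
    · have e1 : (Fin.snoc b s : Fin (n + 2) → ℕ) ⟨i, by omega⟩ = b ⟨i, by omega⟩ :=
        Fin.snoc_castSucc (α := fun _ => ℕ) s b ⟨i, by omega⟩
      beta_reduce
      rw [e1]
      rcases Nat.lt_or_ge (i + 1) (n + 1) with h | h
      · have e2 : (Fin.snoc b s : Fin (n + 2) → ℕ) ⟨i + 1, hi⟩ = b ⟨i + 1, h⟩ :=
          Fin.snoc_castSucc (α := fun _ => ℕ) s b ⟨i + 1, h⟩
        rw [e2]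
        exact hm i h
      · obtain rfl : i = n := by omega
        have e2 : (Fin.snoc b s : Fin (i + 2) → ℕ) ⟨i + 1, hi⟩ = s :=
          Fin.snoc_last (α := fun _ => ℕ) s b
        have e3 : b ⟨i, by omega⟩ = t := hlast
        rw [e2, e3]
        exact hts
    · exact (Fin.snoc_castSucc (α := fun _ => ℕ) s b 0).trans h0
    · exact Fin.snoc_last (α := fun _ => ℕ) s b
    · exact (Fin.snoc_castSucc (α := fun _ => ℕ) s b (Fin.last n)).trans hlast

/-- Removing the last entry of an alternating sequence. -/
theorem altNum_add_two (k n r s : ℕ) (hs : 1 ≤ s) (hsk : s ≤ k) :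
    altNum k (n + 2) r s =
      ∑ t ∈ Finset.Icc 1 k, if (if Even n then t ≤ s else s ≤ t) then altNum k (n + 1) r t else 0 := by
  classical
  have hfin := altSeqs_finite k (n + 2) r s
  rw [altNum, Set.ncard_eq_toFinset_card _ hfin,
    Finset.card_eq_sum_card_fiberwise (f := fun a => a (Fin.last n).castSucc)
      (t := Finset.Icc 1 k)]
  · refine Finset.sum_congr rfl fun t _ => ?_
    rw [← Set.ncard_coe_finset]
    have hset : ((hfin.toFinset.filter fun a => a (Fin.last n).castSucc = t : Finset _) :
        Set (Fin (n + 2) → ℕ)) = {a ∈ altSeqs k (n + 2) r s | a (Fin.last n).castSucc = t} := by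
      ext a; simp
    rw [hset]
    by_cases h : if Even n then t ≤ s else s ≤ t
    · rw [if_pos h, altSeqs_fiber k n r s t hs hsk h, Set.ncard_image_of_injective, altNum]
      exact Fin.snoc_left_injective (α := fun _ => ℕ) s
    · rw [if_neg h]
      convert Set.ncard_empty (Fin (n + 2) → ℕ)
      rw [Set.eq_empty_iff_forall_notMem]
      rintro a ⟨⟨hb, hm, hn, h0, h1⟩, rfl⟩
      have h1' : a ⟨n + 1, by omega⟩ = s := h1
      have := hm n (by omega)
      rw [h1'] at this
      exact h this
  · intro a ha
    have ha' : a ∈ altSeqs k (n + 2) r s := by simpa using ha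
    simpa using ha'.1 _

/-! ### First-step recursion for bounded up-down paths. -/

theorem upDownPaths_finite (k n r s : ℕ) : (upDownPaths k n r s).Finite := by
  refine (Set.Finite.pi' (fun _ : Fin (n + 1) => Set.finite_Iic k)).subset ?_
  rintro a ⟨-, -, h, -⟩ i
  exact h i

theorem pathNum_zero (k r s : ℕ) (hr : r ≤ k) : pathNum k 0 r s = if r = s then 1 else 0 := by
  unfold pathNum
  split_ifs with h
  · subst h
    rw [Set.ncard_eq_one]
    refine ⟨fun _ => r, ?_⟩
    ext a
    constructor
    · rintro ⟨h0, -⟩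
      funext i
      rw [Subsingleton.elim (α := Fin 1) i 0]
      exact h0
    · rintro rfl
      exact ⟨rfl, rfl, fun _ => hr, fun i => i.elim0⟩
  · rw [Set.ncard_eq_zero (upDownPaths_finite k 0 r s), Set.eq_empty_iff_forall_notMem]
    rintro a ⟨h0, h1, -⟩
    exact h (h0.symm.trans h1)

theorem cons_mem_upDownPaths (k n r t s : ℕ) (hr : r ≤ k) (hrt : t = r + 1 ∨ r = t + 1)
    (a : Fin (n + 1) → ℕ) (ha : a ∈ upDownPaths k n t s) :
    (Fin.cons r a : Fin (n + 2) → ℕ) ∈ upDownPaths k (n + 1) r s := by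
  obtain ⟨h0, h1, hb, hst⟩ := ha
  refine ⟨Fin.cons_zero .., ?_, fun i => ?_, fun i => ?_⟩
  · rw [← Fin.succ_last, Fin.cons_succ, h1]
  · induction i using Fin.cases with
    | zero => simpa using hr
    | succ i => simpa using hb i
  · induction i using Fin.cases with
    | zero => simpa [h0] using hrt
    | succ i =>
      rw [Fin.cons_succ, ← Fin.succ_castSucc, Fin.cons_succ]
      exact hst i

/-- Removing the first step of an up-down path. -/
theorem pathNum_succ (k n r s : ℕ) (hr : r ≤ k) :
    pathNum k (n + 1) r s =
      (if r < k then pathNum k n (r + 1) s else 0) + if 0 < r then pathNum k n (r - 1) s else 0 := by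
  let f : (Fin (n + 1) → ℕ) → (Fin (n + 2) → ℕ) := fun a => Fin.cons r a
  have hf : Function.Injective f := Fin.cons_right_injective (α := fun _ => ℕ) r
  have hset : upDownPaths k (n + 1) r s =
      f '' (if r < k then upDownPaths k n (r + 1) s else ∅) ∪
      f '' (if 0 < r then upDownPaths k n (r - 1) s else ∅) := by
    ext a
    constructor
    · rintro ⟨h0, h1, hb, hst⟩
      have htail : f (Fin.tail a) = a := by
        simp only [f]
        rw [← h0]
        exact Fin.cons_self_tail a
      have hmem : Fin.tail a ∈ upDownPaths k n (a 1) s :=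
        ⟨rfl, h1, fun i => hb _, fun i => hst i.succ⟩
      have hk := hb 1
      rcases hst 0 with h | h
      · have h' : a 1 = r + 1 := by rw [← h0]; exact h
        left
        refine ⟨Fin.tail a, ?_, htail⟩
        rw [if_pos (by omega), ← h']
        exact hmem
      · have h' : r = a 1 + 1 := by rw [← h0]; exact h
        right
        refine ⟨Fin.tail a, ?_, htail⟩
        rw [if_pos (by omega), show r - 1 = a 1 by omega]
        exact hmem
    · rintro (⟨b, hb, rfl⟩ | ⟨b, hb, rfl⟩)
      · split_ifs at hb with h
        · exact cons_mem_upDownPaths k n r (r + 1) s hr (Or.inl rfl) b hb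
        · exact hb.elim
      · split_ifs at hb with h
        · exact cons_mem_upDownPaths k n r (r - 1) s hr (Or.inr (by omega)) b hb
        · exact hb.elim
  have hdisj : Disjoint (f '' (if r < k then upDownPaths k n (r + 1) s else ∅))
      (f '' (if 0 < r then upDownPaths k n (r - 1) s else ∅)) := by
    rw [Set.disjoint_image_iff hf, Set.disjoint_left]
    intro b hb hb'
    split_ifs at hb hb'
    · have h1 := hb.1
      have h2 := hb'.1
      omega
    all_goals simp at hb hb'
  have hfin1 : (if r < k then upDownPaths k n (r + 1) s else ∅).Finite := by
    split_ifs
    exacts [upDownPaths_finite .., Set.finite_empty]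
  have hfin2 : (if 0 < r then upDownPaths k n (r - 1) s else ∅).Finite := by
    split_ifs
    exacts [upDownPaths_finite .., Set.finite_empty]
  rw [pathNum, hset, Set.ncard_union_eq hdisj (hfin1.image f) (hfin2.image f),
    Set.ncard_image_of_injective _ hf, Set.ncard_image_of_injective _ hf]
  congr 1 <;> split_ifs <;> simp [pathNum]

/-! ### Two-sided linear recurrences: existence and uniqueness of extensions. -/

/-- The shift operator on two-sided sequences. -/
def shiftEnd (K : Type*) [Field K] : Module.End K (ℤ → K) where
  toFun b := fun m => b (m + 1)
  map_add' _ _ := rfl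
  map_smul' _ _ := rfl

theorem shiftEnd_pow_apply {K : Type*} [Field K] (b : ℤ → K) (i : ℕ) (m : ℤ) :
    ((shiftEnd K) ^ i) b m = b (m + i) := by
  induction i generalizing m with
  | zero => simp
  | succ i ih =>
    rw [pow_succ', Module.End.mul_apply]
    change ((shiftEnd K ^ i) b) (m + 1) = _
    rw [ih]
    congr 1
    push_cast
    ring

open Polynomial in
theorem aeval_shiftEnd_apply {K : Type*} [Field K] (p : K[X]) {N : ℕ} (hN : p.natDegree < N)
    (b : ℤ → K) (m : ℤ) :
    aeval (shiftEnd K) p b m = ∑ i ∈ Finset.range N, p.coeff i * b (m + i) := by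
  rw [aeval_eq_sum_range' hN, LinearMap.sum_apply, Finset.sum_apply]
  refine Finset.sum_congr rfl fun i _ => ?_
  rw [LinearMap.smul_apply, Pi.smul_apply, shiftEnd_pow_apply, smul_eq_mul]

open Polynomial in
/-- The characteristic polynomial of a linear recurrence. -/
noncomputable def recPoly {K : Type*} [Field K] (d : ℕ) (c : ℕ → K) : K[X] :=
  ∑ i ∈ Finset.range (d + 1), Polynomial.monomial i (c i)

open Polynomial in
theorem recPoly_coeff {K : Type*} [Field K] (d : ℕ) (c : ℕ → K) (i : ℕ) :
    (recPoly d c).coeff i = if i < d + 1 then c i else 0 := by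
  simp [recPoly, Polynomial.coeff_monomial]

theorem recPoly_natDegree_lt {K : Type*} [Field K] (d : ℕ) (c : ℕ → K) :
    (recPoly d c).natDegree < d + 1 := by
  rw [Nat.lt_succ_iff, Polynomial.natDegree_le_iff_coeff_eq_zero]
  intro N hN
  rw [recPoly_coeff, if_neg (by omega)]

open Polynomial in
theorem aeval_shiftEnd_recPoly {K : Type*} [Field K] (d : ℕ) (c : ℕ → K) (b : ℤ → K)
    (h : ∀ m : ℤ, ∑ i ∈ Finset.range (d + 1), c i * b (m + i) = 0) :
    aeval (shiftEnd K) (recPoly d c) b = 0 := by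
  funext m
  rw [aeval_shiftEnd_apply _ (recPoly_natDegree_lt d c), Pi.zero_apply, ← h m]
  refine Finset.sum_congr rfl fun i hi => ?_
  rw [recPoly_coeff, if_pos (Finset.mem_range.mp hi)]

open Polynomial in
/-- A two-sided sequence annihilated by a polynomial in the shift with non-zero constant term
vanishes if it vanishes at all non-negative indices. -/
theorem eq_zero_of_aeval_shiftEnd {K : Type*} [Field K] (p : K[X]) (hp : p.coeff 0 ≠ 0)
    (b : ℤ → K) (hb : ∀ n : ℕ, b n = 0) (h : aeval (shiftEnd K) p b = 0) : b = 0 := by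
  -- Downward induction: the recurrence at the new index determines that value from later ones,
  -- because the constant coefficient is invertible.
  have key : ∀ n : ℕ, ∀ m : ℤ, -(n : ℤ) ≤ m → b m = 0 := by
    intro n
    induction n with
    | zero =>
      intro m hm
      obtain ⟨l, rfl⟩ := Int.eq_ofNat_of_zero_le (show 0 ≤ m by simpa using hm)
      exact hb l
    | succ n ih =>
      intro m hm
      rcases eq_or_lt_of_le hm with rfl | hlt
      · have := congrFun h (-((n + 1 : ℕ) : ℤ))
        rw [aeval_shiftEnd_apply p (Nat.lt_succ_self _), Finset.sum_range_succ', Pi.zero_apply,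
          Finset.sum_eq_zero, zero_add] at this
        · simpa [hp] using this
        · intro i _
          rw [ih _ (by push_cast; omega), mul_zero]
      · exact ih m (by push_cast at hlt; omega)
  funext m
  exact key m.natAbs m (by omega)

/-- Two-sided sequences that satisfy linear recurrences with non-zero trailing coefficients and agree
at all non-negative indices are equal. -/
theorem recurrence_unique {K : Type*} [Field K] (b b' : ℤ → K) (d d' : ℕ) (c c' : ℕ → K)
    (hc : c 0 ≠ 0) (hc' : c' 0 ≠ 0)
    (h : ∀ m : ℤ, ∑ i ∈ Finset.range (d + 1), c i * b (m + i) = 0)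
    (h' : ∀ m : ℤ, ∑ i ∈ Finset.range (d' + 1), c' i * b' (m + i) = 0)
    (hbb : ∀ n : ℕ, b n = b' n) : b = b' := by
  rw [← sub_eq_zero]
  -- The two sequences may obey different recurrences; the product of the characteristic polynomials
  -- annihilates both.
  refine eq_zero_of_aeval_shiftEnd (recPoly d c * recPoly d' c') ?_ _ ?_ ?_
  · rw [Polynomial.mul_coeff_zero, recPoly_coeff, recPoly_coeff, if_pos (by omega),
      if_pos (by omega)]
    exact mul_ne_zero hc hc'
  · intro n
    simp [hbb]
  · have e : Polynomial.aeval (shiftEnd K) (recPoly d c * recPoly d' c') b = 0 := by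
      rw [mul_comm, map_mul, Module.End.mul_apply, aeval_shiftEnd_recPoly d c b h, map_zero]
    have e' : Polynomial.aeval (shiftEnd K) (recPoly d c * recPoly d' c') b' = 0 := by
      rw [map_mul, Module.End.mul_apply, aeval_shiftEnd_recPoly d' c' b' h', map_zero]
    rw [map_sub, e, e', sub_zero]

open Polynomial in
/-- The linear functional `X ^ n ↦ u n` on polynomials. -/
noncomputable def seqFunctional (u : ℕ → ℚ) : ℚ[X] →ₗ[ℚ] ℚ :=
  (Polynomial.basisMonomials ℚ).constr ℚ u

open Polynomial in
theorem seqFunctional_X_pow_mul (u : ℕ → ℚ) (p : ℚ[X]) (n : ℕ) :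
    seqFunctional u (X ^ n * p) = ∑ i ∈ Finset.range (p.natDegree + 1), p.coeff i * u (n + i) := by
  conv_lhs => rw [p.as_sum_range_C_mul_X_pow, Finset.mul_sum, map_sum]
  refine Finset.sum_congr rfl fun i _ => ?_
  have h1 : (X : ℚ[X]) ^ n * (C (p.coeff i) * X ^ i) = p.coeff i • basisMonomials ℚ (n + i) := by
    rw [coe_basisMonomials, Polynomial.smul_monomial, smul_eq_mul, mul_one,
      ← C_mul_X_pow_eq_monomial]
    ring
  rw [h1, map_smul, seqFunctional, Module.Basis.constr_basis, smul_eq_mul]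

open Polynomial in
/-- A sequence satisfying a linear recurrence whose characteristic polynomial has non-zero constant
term has an extension to all integer indices. -/
theorem exists_recurrenceExtension (u : ℕ → ℚ) (p : ℚ[X]) (hp : p.coeff 0 ≠ 0)
    (h : ∀ n : ℕ, ∑ i ∈ Finset.range (p.natDegree + 1), p.coeff i * u (n + i) = 0) :
    ∃ b : ℤ → ℚ, (∀ n : ℕ, b n = u n) ∧
      ∀ m : ℤ, ∑ i ∈ Finset.range (p.natDegree + 1), p.coeff i * b (m + i) = 0 := by
  -- A non-zero constant term makes the class of `X` invertible modulo `p`, so negative powers of it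
  -- exist. The functional `X ^ n ↦ u n` kills multiples of `p` and descends to the quotient, where
  -- it is evaluated at all integer powers.
  have hunit : IsUnit (AdjoinRoot.root p) := by
    have hX : p = X * p.divX + C (p.coeff 0) := (X_mul_divX_add p).symm
    have h0 : AdjoinRoot.root p * AdjoinRoot.mk p p.divX + AdjoinRoot.mk p (C (p.coeff 0)) = 0 := by
      rw [← AdjoinRoot.mk_X, ← map_mul, ← map_add, ← hX, AdjoinRoot.mk_self]
    refine IsUnit.of_mul_eq_one (AdjoinRoot.mk p (C (-(p.coeff 0)⁻¹) * p.divX)) ?_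
    have h2 : AdjoinRoot.mk p (C (-(p.coeff 0)⁻¹)) * AdjoinRoot.mk p (C (p.coeff 0)) = -1 := by
      rw [← map_mul, ← C_mul, neg_mul, inv_mul_cancel₀ hp, C_neg, C_1, map_neg, map_one]
    rw [map_mul]
    linear_combination AdjoinRoot.mk p (C (-(p.coeff 0)⁻¹)) * h0 - h2
  obtain ⟨x, hx⟩ := hunit
  have hker : ∀ q : ℚ[X], p ∣ q → seqFunctional u q = 0 := by
    rintro q ⟨r, rfl⟩
    conv_lhs => rw [r.as_sum_range_C_mul_X_pow, Finset.mul_sum, map_sum]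
    refine Finset.sum_eq_zero fun i _ => ?_
    rw [show p * (C (r.coeff i) * X ^ i) = r.coeff i • (X ^ i * p) by
      rw [Polynomial.smul_eq_C_mul]; ring, map_smul, seqFunctional_X_pow_mul, h, smul_zero]
  let φ : AdjoinRoot p → ℚ := fun y => seqFunctional u (AdjoinRoot.mk_surjective y).choose
  have hφ : ∀ q : ℚ[X], φ (AdjoinRoot.mk p q) = seqFunctional u q := by
    intro q
    have h1 := (AdjoinRoot.mk_surjective (AdjoinRoot.mk p q)).choose_spec
    rw [AdjoinRoot.mk_eq_mk] at h1
    have h2 := hker _ h1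
    rwa [map_sub, sub_eq_zero] at h2
  refine ⟨fun m => φ ((x ^ m : (AdjoinRoot p)ˣ) : AdjoinRoot p), fun n => ?_, fun m => ?_⟩
  · have h1 : ((x ^ (n : ℤ) : (AdjoinRoot p)ˣ) : AdjoinRoot p) = AdjoinRoot.mk p (X ^ n * 1) := by
      simp [hx]
    have h2 := seqFunctional_X_pow_mul u 1 n
    simp only [h1, hφ, h2]
    simp
  · obtain ⟨q, hq⟩ := AdjoinRoot.mk_surjective ((x ^ m : (AdjoinRoot p)ˣ) : AdjoinRoot p)
    have h1 : ∀ i : ℕ, ((x ^ (m + i) : (AdjoinRoot p)ˣ) : AdjoinRoot p) =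
        AdjoinRoot.mk p (q * X ^ i) := by
      intro i
      rw [zpow_add, Units.val_mul, ← hq]
      simp [hx]
    simp only [h1, hφ]
    rw [← hker (q * p) (dvd_mul_left _ _)]
    conv_rhs => rw [p.as_sum_range_C_mul_X_pow, Finset.mul_sum, map_sum]
    refine Finset.sum_congr rfl fun i _ => ?_
    rw [show q * (C (p.coeff i) * X ^ i) = p.coeff i • (q * X ^ i) by
      rw [Polynomial.smul_eq_C_mul]; ring, map_smul, smul_eq_mul]

open Polynomial in
/-- A sequence satisfying a linear recurrence with non-zero extreme coefficients has a unique
extension to all integer indices. -/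
theorem existsUnique_recurrenceExtension (u : ℕ → ℚ) (p : ℚ[X]) (hp : p.coeff 0 ≠ 0)
    (h : ∀ n : ℕ, ∑ i ∈ Finset.range (p.natDegree + 1), p.coeff i * u (n + i) = 0) :
    ∃! b : ℤ → ℚ, IsRecurrenceExtension u b := by
  obtain ⟨b, hb, hr⟩ := exists_recurrenceExtension u p hp h
  refine ⟨b, ⟨hb, p.natDegree, p.coeff, hp, ?_, hr⟩, ?_⟩
  · rw [Polynomial.coeff_natDegree, Ne, Polynomial.leadingCoeff_eq_zero]
    rintro rfl
    exact hp (Polynomial.coeff_zero 0)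
  · rintro b' ⟨hb', d, c, hc, -, hr'⟩
    exact recurrence_unique b' b d p.natDegree c p.coeff hc hp hr' hr
      fun n => (hb' n).trans (hb n).symm

/-! ### Products of sines in the manner of Gauss's lemma. -/

theorem sin_nat_mul_pi_div (m N : ℕ) (hN : 0 < N) :
    Real.sin (m * Real.pi / N) = (-1) ^ (m / N) * Real.sin ((m % N : ℕ) * Real.pi / N) := by
  have hN' : (N : ℝ) ≠ 0 := by positivity
  have h : (m : ℝ) * Real.pi / N = (m % N : ℕ) * Real.pi / N + (m / N : ℕ) * Real.pi := by
    have h1 : (m : ℝ) = (m % N : ℕ) + N * (m / N : ℕ) := by exact_mod_cast (Nat.mod_add_div m N).symm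
    rw [h1]
    field_simp
  rw [h, Real.sin_add_nat_mul_pi]

theorem sin_sub_mul_pi_div (m N : ℕ) (hN : 0 < N) (hm : m ≤ N) :
    Real.sin ((N - m : ℕ) * Real.pi / N) = Real.sin (m * Real.pi / N) := by
  have hN' : (N : ℝ) ≠ 0 := by positivity
  rw [Nat.cast_sub hm, ← Real.sin_pi_sub]
  congr 1
  field_simp
  ring

/-- The distance of `i * c` from the nearest multiple of `N`. -/
def distRes (c N i : ℕ) : ℕ := min (i * c % N) (N - i * c % N)

theorem distRes_mem (c k i : ℕ) (hc : Nat.Coprime c (2 * k + 1)) (hi : i ∈ Finset.Icc 1 k) :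
    distRes c (2 * k + 1) i ∈ Finset.Icc 1 k := by
  rw [Finset.mem_Icc] at hi ⊢
  have hlt := Nat.mod_lt (i * c) (show 0 < 2 * k + 1 by omega)
  have hpos : i * c % (2 * k + 1) ≠ 0 := by
    intro h
    have h1 := hc.symm.dvd_of_dvd_mul_right (Nat.dvd_of_mod_eq_zero h)
    have := Nat.le_of_dvd (by omega) h1
    omega
  unfold distRes
  omega

/-- Equal distances mean `i c ≡ ± j c`, and cancelling `c` shows that `2k+1` divides `i - j` or `i +
j`. The latter lies strictly between `0` and `2k+1`, so only `i = j` remains. -/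
theorem distRes_injOn (c k : ℕ) (hc : Nat.Coprime c (2 * k + 1)) :
    Set.InjOn (distRes c (2 * k + 1)) (Finset.Icc 1 k) := by
  intro i hi j hj h
  simp only [Finset.coe_Icc, Set.mem_Icc] at hi hj
  have hli := Nat.mod_lt (i * c) (show 0 < 2 * k + 1 by omega)
  have hlj := Nat.mod_lt (j * c) (show 0 < 2 * k + 1 by omega)
  have hdi := Nat.mod_add_div (i * c) (2 * k + 1)
  have hdj := Nat.mod_add_div (j * c) (2 * k + 1)
  unfold distRes at h
  have hcop : IsCoprime ((2 * k + 1 : ℕ) : ℤ) (c : ℤ) := Nat.isCoprime_iff_coprime.mpr hc.symm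
  have hcases : i * c % (2 * k + 1) = j * c % (2 * k + 1) ∨
      i * c % (2 * k + 1) + j * c % (2 * k + 1) = 2 * k + 1 := by omega
  have hdvd : ((2 * k + 1 : ℕ) : ℤ) ∣ (i : ℤ) - j ∨ ((2 * k + 1 : ℕ) : ℤ) ∣ (i : ℤ) + j := by
    rcases hcases with h1 | h1
    · left
      refine hcop.dvd_of_dvd_mul_right ?_
      rw [sub_mul]
      exact_mod_cast (Nat.modEq_iff_dvd.mp (Nat.ModEq.symm h1) : _)
    · right
      refine hcop.dvd_of_dvd_mul_right ?_
      rw [← Nat.cast_add, ← Nat.cast_mul, Int.natCast_dvd_natCast, add_mul, ← hdi, ← hdj]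
      refine ⟨1 + i * c / (2 * k + 1) + j * c / (2 * k + 1), ?_⟩
      linear_combination h1
  rcases hdvd with hd | hd
  · have := Int.eq_zero_of_abs_lt_dvd hd (by rw [abs_lt]; push_cast; constructor <;> linarith)
    omega
  · have := Int.le_of_dvd (by omega) hd
    push_cast at this
    omega

/-- Each half-turn removed from the angle contributes a sign, counted by the quotient. The remaining
sine depends only on the distance to the nearest multiple, and these distances permute `1, …, k`. -/
theorem prod_sin_mul_of_coprime (k c : ℕ) (hc : Nat.Coprime c (2 * k + 1)) :
    ∏ i ∈ Finset.Icc 1 k, Real.sin ((i * c : ℕ) * Real.pi / (2 * k + 1 : ℕ)) =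
      (-1) ^ (∑ i ∈ Finset.Icc 1 k, i * c / (2 * k + 1)) *
        ∏ i ∈ Finset.Icc 1 k, Real.sin (i * Real.pi / (2 * k + 1 : ℕ)) := by
  have himg : (Finset.Icc 1 k).image (distRes c (2 * k + 1)) = Finset.Icc 1 k := by
    refine Finset.eq_of_subset_of_card_le ?_ ?_
    · intro x hx
      obtain ⟨i, hi, rfl⟩ := Finset.mem_image.mp hx
      exact distRes_mem c k i hc hi
    · rw [Finset.card_image_of_injOn (distRes_injOn c k hc)]
  conv_rhs => rw [← himg, Finset.prod_image (distRes_injOn c k hc), himg]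
  rw [← Finset.prod_pow_eq_pow_sum, ← Finset.prod_mul_distrib]
  refine Finset.prod_congr rfl fun i _ => ?_
  rw [sin_nat_mul_pi_div _ _ (by omega)]
  congr 1
  have hlt := Nat.mod_lt (i * c) (show 0 < 2 * k + 1 by omega)
  unfold distRes
  rcases le_total (i * c % (2 * k + 1)) (2 * k + 1 - i * c % (2 * k + 1)) with h | h
  · rw [min_eq_left h]
  · rw [min_eq_right h, sin_sub_mul_pi_div _ _ (by omega) hlt.le]

theorem prod_sin_mul_of_not_coprime (k c : ℕ) (hc : ¬ Nat.Coprime c (2 * k + 1)) :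
    ∏ i ∈ Finset.Icc 1 k, Real.sin ((i * c : ℕ) * Real.pi / (2 * k + 1 : ℕ)) = 0 := by
  obtain ⟨a, ha⟩ := Nat.gcd_dvd_left c (2 * k + 1)
  obtain ⟨i, hi⟩ := Nat.gcd_dvd_right c (2 * k + 1)
  set g := Nat.gcd c (2 * k + 1) with hg
  have hg1 : g ≠ 1 := hc
  have hg0 : g ≠ 0 := by rintro h; rw [h] at hi; omega
  have hi0 : 0 < i := Nat.pos_of_ne_zero (by rintro rfl; omega)
  have hik : 2 * i ≤ 2 * k + 1 := by rw [hi]; exact Nat.mul_le_mul_right i (by omega)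
  -- The index `i = (2k+1)/g` is at most `k` since `g ≥ 2`, and it makes the angle an integer
  -- multiple of `π`.
  refine Finset.prod_eq_zero (i := i) (Finset.mem_Icc.mpr (by omega)) ?_
  have hN : ((2 * k + 1 : ℕ) : ℝ) ≠ 0 := by positivity
  have : ((i * c : ℕ) : ℝ) * Real.pi / (2 * k + 1 : ℕ) = (a : ℕ) * Real.pi := by
    have h1 : ((i * c : ℕ) : ℝ) = a * (2 * k + 1 : ℕ) := by
      rw [← Nat.cast_mul, ha, hi]
      congr 1
      ring
    rw [h1]
    field_simp
  rw [this, Real.sin_nat_mul_pi]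

/-! ### The transfer matrix and its inverse. -/

section

open Matrix

/-- The matrix of the relation `≤` on `Fin k`. -/
def leMatrix (R : Type*) [Zero R] [One R] (k : ℕ) : Matrix (Fin k) (Fin k) R :=
  of fun i j => if i ≤ j then 1 else 0

/-- The inverse of `leMatrix`. -/
def leMatrixInv (k : ℕ) : Matrix (Fin k) (Fin k) ℝ :=
  of fun i j => if j = i then 1 else if (j : ℕ) = i + 1 then -1 else 0

theorem sum_leMatrixInv_mul (k : ℕ) (f : ℕ → ℝ) (i : Fin k) :
    ∑ l : Fin k, leMatrixInv k i l * f l = f i - if (i : ℕ) + 1 < k then f (i + 1) else 0 := by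
  have h : ∀ l : Fin k, leMatrixInv k i l * f l =
      (if l = i then f i else 0) - if (l : ℕ) = i + 1 then f (i + 1) else 0 := by
    intro l
    simp only [leMatrixInv, of_apply]
    by_cases h1 : l = i
    · subst h1; simp
    · by_cases h2 : (l : ℕ) = i + 1
      · simp [h1, h2]
      · simp [h1, h2]
  rw [Finset.sum_congr rfl fun l _ => h l, Finset.sum_sub_distrib, Finset.sum_ite_eq' Finset.univ i,
    if_pos (Finset.mem_univ _)]
  congr 1
  split_ifs with h1
  · rw [Finset.sum_eq_single (⟨i + 1, h1⟩ : Fin k)]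
    · simp
    · intro b _ hb
      rw [if_neg]
      intro h2
      exact hb (Fin.ext h2)
    · simp
  · refine Finset.sum_eq_zero fun l _ => if_neg ?_
    have := l.2
    omega

theorem sum_mul_leMatrixInv (k : ℕ) (f : ℕ → ℝ) (j : Fin k) :
    ∑ l : Fin k, f l * leMatrixInv k l j = f j - if (j : ℕ) = 0 then 0 else f (j - 1) := by
  have h : ∀ l : Fin k, f l * leMatrixInv k l j =
      (if l = j then f j else 0) - if (j : ℕ) = l + 1 then f (j - 1) else 0 := by
    intro l
    simp only [leMatrixInv, of_apply]
    by_cases h1 : l = j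
    · subst h1; simp
    · by_cases h2 : (j : ℕ) = l + 1
      · simp [h1, Ne.symm h1, h2]
      · simp [h1, Ne.symm h1, h2]
  rw [Finset.sum_congr rfl fun l _ => h l, Finset.sum_sub_distrib, Finset.sum_ite_eq' Finset.univ j,
    if_pos (Finset.mem_univ _)]
  congr 1
  split_ifs with h1
  · exact Finset.sum_eq_zero fun l _ => if_neg (by omega)
  · have hj := j.2
    rw [Finset.sum_eq_single (⟨j - 1, by omega⟩ : Fin k)]
    · rw [if_pos]
      simp only
      omega
    · intro b _ hb
      rw [if_neg]
      intro h2
      exact hb (Fin.ext (by simp only; omega))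
    · simp

theorem leMatrix_mul_inv (k : ℕ) : leMatrix ℝ k * leMatrixInv k = 1 := by
  ext i j
  rw [mul_apply]
  have h := sum_mul_leMatrixInv k (fun l => if (i : ℕ) ≤ l then 1 else 0) j
  have h' : ∀ l : Fin k, leMatrix ℝ k i l = if (i : ℕ) ≤ l then 1 else 0 := fun l => rfl
  simp only [h', h, one_apply, Fin.ext_iff]
  split_ifs <;> first | omega | simp

theorem inv_mul_leMatrix (k : ℕ) : leMatrixInv k * leMatrix ℝ k = 1 :=
  mul_eq_one_comm.mp (leMatrix_mul_inv k)

theorem det_leMatrix (k : ℕ) : (leMatrix ℝ k).det = 1 := by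
  rw [det_of_isUpperTriangular]
  · simp [leMatrix]
  · intro i j hij
    exact if_neg (not_le.mpr hij)

/-- The transfer matrix of two consecutive steps of an alternating sequence. -/
def stepMatrix (R : Type*) [Semiring R] (k : ℕ) : Matrix (Fin k) (Fin k) R :=
  leMatrix R k * (leMatrix R k)ᵀ

/-- The inverse of `stepMatrix`. -/
def stepMatrixInv (k : ℕ) : Matrix (Fin k) (Fin k) ℝ :=
  (leMatrixInv k)ᵀ * leMatrixInv k

theorem stepMatrix_mul_inv (k : ℕ) : stepMatrix ℝ k * stepMatrixInv k = 1 := by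
  rw [stepMatrix, stepMatrixInv, Matrix.mul_assoc, ← Matrix.mul_assoc (leMatrix ℝ k)ᵀ,
    ← transpose_mul, inv_mul_leMatrix, transpose_one, Matrix.one_mul, leMatrix_mul_inv]

theorem inv_mul_stepMatrix (k : ℕ) : stepMatrixInv k * stepMatrix ℝ k = 1 :=
  mul_eq_one_comm.mp (stepMatrix_mul_inv k)

theorem det_stepMatrix (k : ℕ) : (stepMatrix ℝ k).det = 1 := by
  rw [stepMatrix, det_mul, det_transpose, det_leMatrix, one_mul]

theorem stepMatrixInv_transpose (k : ℕ) : (stepMatrixInv k)ᵀ = stepMatrixInv k := by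
  rw [stepMatrixInv, transpose_mul, transpose_transpose]

theorem stepMatrix_mul_inv_transpose (k : ℕ) :
    stepMatrix ℝ k * (leMatrixInv k)ᵀ = leMatrix ℝ k := by
  rw [stepMatrix, Matrix.mul_assoc, ← transpose_mul, inv_mul_leMatrix, transpose_one, Matrix.mul_one]

/-! ### Krylov matrices and Hankel determinants. -/

/-- The matrix with columns `v, T v, T² v, …`. -/
def krylov {k : ℕ} (T : Matrix (Fin k) (Fin k) ℝ) (v : Fin k → ℝ) : Matrix (Fin k) (Fin k) ℝ :=
  of fun i j => (T ^ (j : ℕ) *ᵥ v) i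

/-- By symmetry of `T` the left powers can be moved onto `u`, so the matrix is the product `(krylov
T u)ᵀ * C * krylov T v`. -/
theorem det_hankel_eq {k : ℕ} (T C : Matrix (Fin k) (Fin k) ℝ) (hT : Tᵀ = T) (u v : Fin k → ℝ) :
    (of fun i j : Fin k => u ⬝ᵥ ((T ^ (i : ℕ) * C * T ^ (j : ℕ)) *ᵥ v)).det =
      (krylov T u).det * C.det * (krylov T v).det := by
  rw [← det_transpose (krylov T u), ← det_mul, ← det_mul]
  congr 1
  ext i j
  have h1 : ((krylov T u)ᵀ * C * krylov T v) i j =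
      (krylov T u)ᵀ i ⬝ᵥ (C *ᵥ (fun l => krylov T v l j)) := by
    rw [Matrix.mul_assoc]; rfl
  rw [h1, of_apply, Matrix.mul_assoc, ← mulVec_mulVec, dotProduct_mulVec, ← mulVec_transpose,
    transpose_pow, hT, ← mulVec_mulVec]
  rfl

/-- In the eigenbasis the `j`-th Krylov column is the vector `W v` scaled entrywise by `x i ^ j`,
hence `W * krylov T v` is a diagonal matrix times a Vandermonde matrix. -/
theorem det_krylov_mul {k : ℕ} (T W : Matrix (Fin k) (Fin k) ℝ) (x : Fin k → ℝ)
    (h : W * T = diagonal x * W) (v : Fin k → ℝ) :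
    W.det * (krylov T v).det = (∏ i, (W *ᵥ v) i) * (vandermonde x).det := by
  have hpow : ∀ n : ℕ, W * T ^ n = diagonal (fun i => x i ^ n) * W := by
    intro n
    induction n with
    | zero => simp
    | succ n ih =>
      rw [pow_succ, ← Matrix.mul_assoc, ih, Matrix.mul_assoc, h, ← Matrix.mul_assoc,
        diagonal_mul_diagonal]
      simp only [pow_succ]
  rw [← det_mul, ← det_diagonal, ← det_mul]
  congr 1
  ext i j
  have h1 : (W * krylov T v) i j = (W *ᵥ (T ^ (j : ℕ) *ᵥ v)) i := rfl
  rw [h1, mulVec_mulVec, hpow, ← mulVec_mulVec, mulVec_diagonal, diagonal_mul, vandermonde_apply,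
    mul_comm]

theorem det_hankel_stepMatrix (k m : ℕ) (u v : Fin k → ℝ) :
    (of fun i j : Fin k => u ⬝ᵥ (stepMatrix ℝ k ^ (m + i + j) *ᵥ v)).det =
      (krylov (stepMatrixInv k) u).det * (krylov (stepMatrixInv k) v).det := by
  have hcancel : ∀ i, stepMatrixInv k ^ i * stepMatrix ℝ k ^ i = 1 := by
    intro i
    rw [← Commute.mul_pow, inv_mul_stepMatrix, one_pow]
    exact (inv_mul_stepMatrix k).trans (stepMatrix_mul_inv k).symm
  have hcancel' : ∀ i, stepMatrix ℝ k ^ i * stepMatrixInv k ^ i = 1 := fun i =>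
    mul_eq_one_comm.mp (hcancel i)
  -- Reversing rows and columns turns the increasing powers of `stepMatrix` into a fixed high power,
  -- of determinant one, flanked by powers of its inverse.
  rw [← det_submatrix_equiv_self Fin.revPerm]
  have h := det_hankel_eq (stepMatrixInv k) (stepMatrix ℝ k ^ (m + (k - 1) + (k - 1)))
    (stepMatrixInv_transpose k) u v
  rw [det_pow, det_stepMatrix, one_pow, mul_one] at h
  rw [← h]
  congr 1
  ext i j
  simp only [submatrix_apply, of_apply, Fin.revPerm_apply, Fin.val_rev]
  congr 2
  have hi := i.2
  have hj := j.2
  have e : m + (k - 1) + (k - 1) = i + (m + (k - (i + 1)) + (k - (j + 1))) + j := by omega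
  rw [e]
  generalize m + (k - (i + 1)) + (k - (j + 1)) = p
  rw [pow_add, pow_add, ← mul_assoc, ← mul_assoc, hcancel, one_mul, mul_assoc, hcancel', mul_one]

theorem stepMatrixInv_apply (k : ℕ) (i j : Fin k) :
    stepMatrixInv k i j = leMatrixInv k i j - if (i : ℕ) = 0 then 0 else
      if (j : ℕ) + 1 = i then 1 else if (j : ℕ) = i then -1 else 0 := by
  let f : ℕ → ℝ := fun l => if (j : ℕ) = l then 1 else if (j : ℕ) = l + 1 then -1 else 0
  have h := sum_mul_leMatrixInv k f i
  have h' : ∀ l : Fin k, leMatrixInv k l j = f l := by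
    intro l
    simp [leMatrixInv, f, Fin.ext_iff]
  rw [stepMatrixInv, mul_apply]
  simp only [transpose_apply, h', mul_comm (leMatrixInv k _ i)]
  rw [h]
  congr 1
  by_cases h0 : (i : ℕ) = 0
  · rw [if_pos h0, if_pos h0]
  · rw [if_neg h0, if_neg h0]
    change (if (j : ℕ) = i - 1 then (1 : ℝ) else if (j : ℕ) = i - 1 + 1 then -1 else 0) = _
    split_ifs <;> first | omega | rfl

theorem stepMatrixInv_eq_zero (k : ℕ) (i j : Fin k) (h : (j : ℕ) + 1 < i) :
    stepMatrixInv k i j = 0 := by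
  simp only [stepMatrixInv_apply, leMatrixInv, of_apply, Fin.ext_iff]
  split_ifs <;> first | omega | simp

theorem stepMatrixInv_subdiagonal (k : ℕ) (i j : Fin k) (h : (j : ℕ) + 1 = i) :
    stepMatrixInv k i j = -1 := by
  simp only [stepMatrixInv_apply, leMatrixInv, of_apply, Fin.ext_iff]
  split_ifs <;> first | omega | simp

/-- The inverse vanishes below its subdiagonal, whose entries are `-1`; each application therefore
pushes the support down by one place and changes the sign of the lowest entry. -/
theorem stepMatrixInv_pow_mulVec (k : ℕ) (hk : 0 < k) (n : ℕ) (i : Fin k) (hi : n ≤ i) :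
    (stepMatrixInv k ^ n *ᵥ Pi.single ⟨0, hk⟩ 1) i = if (i : ℕ) = n then (-1) ^ n else 0 := by
  induction n generalizing i with
  | zero =>
    rw [pow_zero, one_mulVec, Pi.single_apply]
    simp [Fin.ext_iff]
  | succ n ih =>
    rw [pow_succ', ← mulVec_mulVec, mulVec, dotProduct]
    have hterm : ∀ l : Fin k, stepMatrixInv k i l *
        (stepMatrixInv k ^ n *ᵥ Pi.single ⟨0, hk⟩ 1) l =
        if (l : ℕ) = n ∧ (i : ℕ) = n + 1 then (-1) ^ (n + 1) else 0 := by
      intro l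
      rcases lt_or_ge (l : ℕ) n with hl | hl
      · rw [stepMatrixInv_eq_zero _ _ _ (by omega), zero_mul, if_neg (by omega)]
      · rw [ih l hl]
        by_cases hln : (l : ℕ) = n
        · by_cases hin : (i : ℕ) = n + 1
          · rw [stepMatrixInv_subdiagonal _ _ _ (by omega), if_pos hln, if_pos ⟨hln, hin⟩]
            ring
          · rw [stepMatrixInv_eq_zero _ _ _ (by omega), zero_mul, if_neg (by omega)]
        · rw [if_neg hln, mul_zero, if_neg (by omega)]
    rw [Finset.sum_congr rfl fun l _ => hterm l]
    have hik := i.2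
    rw [Finset.sum_eq_single (⟨n, by omega⟩ : Fin k)]
    · simp
    · intro b _ hb
      exact if_neg fun h => hb (Fin.ext h.1)
    · simp

theorem det_krylov_single_zero (k : ℕ) (hk : 0 < k) :
    (krylov (stepMatrixInv k) (Pi.single ⟨0, hk⟩ 1)).det ^ 2 = 1 := by
  rw [det_of_isUpperTriangular]
  · have h : ∀ i : Fin k, krylov (stepMatrixInv k) (Pi.single ⟨0, hk⟩ 1) i i = (-1) ^ (i : ℕ) := by
      intro i
      rw [krylov, of_apply, stepMatrixInv_pow_mulVec k hk _ _ le_rfl, if_pos rfl]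
    rw [Finset.prod_congr rfl fun i _ => h i, Finset.prod_pow_eq_pow_sum, ← pow_mul, mul_comm,
      pow_mul]
    simp
  · intro i j hij
    have hij : j < i := hij
    rw [krylov, of_apply, stepMatrixInv_pow_mulVec k hk _ _ (le_of_lt hij), if_neg]
    exact ne_of_gt (show (j : ℕ) < i from hij)

/-! ### Sine eigenvectors and evaluation of the Krylov determinants. -/

/-- The angles `π/(2k+1), …, kπ/(2k+1)`. -/
noncomputable def oddAngle (k : ℕ) (i : Fin k) : ℝ := ((i : ℕ) + 1 : ℕ) * Real.pi / (2 * k + 1 : ℕ)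

/-- Row eigenvectors of `stepMatrixInv`. -/
noncomputable def sinOddMatrix (k : ℕ) : Matrix (Fin k) (Fin k) ℝ :=
  of fun i j => (-1) ^ (j : ℕ) * Real.sin ((2 * (j : ℕ) + 1 : ℕ) * oddAngle k i)

/-- Companion of `sinOddMatrix`. -/
noncomputable def sinEvenMatrix (k : ℕ) : Matrix (Fin k) (Fin k) ℝ :=
  of fun i j => (-1) ^ (j : ℕ) * Real.sin ((2 * (j : ℕ) + 2 : ℕ) * oddAngle k i)

/-- The alternating signs turn the difference operator `leMatrixInv` into a sum of neighbours, and
`sin (a+θ) + sin (a-θ) = 2 cos θ sin a`. The neighbour missing in the first column would be `sin 0`.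
-/
theorem sinEvenMatrix_mul (k : ℕ) :
    sinEvenMatrix k * leMatrixInv k =
      diagonal (fun i => 2 * Real.cos (oddAngle k i)) * sinOddMatrix k := by
  ext i j
  rw [mul_apply, diagonal_mul]
  have h := sum_mul_leMatrixInv k
    (fun l => (-1) ^ l * Real.sin ((2 * l + 2 : ℕ) * oddAngle k i)) j
  refine Eq.trans h ?_
  set θ := oddAngle k i
  rw [sinOddMatrix, of_apply]
  change _ = 2 * Real.cos θ * ((-1) ^ (j : ℕ) * Real.sin ((2 * (j : ℕ) + 1 : ℕ) * θ))
  rcases Nat.eq_zero_or_pos (j : ℕ) with h0 | h0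
  · rw [if_pos h0, h0]
    simp only [Nat.mul_zero, Nat.zero_add, Nat.cast_one, Nat.cast_ofNat, pow_zero, one_mul]
    rw [Real.sin_two_mul]
    ring
  · obtain ⟨l, hl⟩ : ∃ l, (j : ℕ) = l + 1 := ⟨j - 1, by omega⟩
    rw [if_neg (by omega), hl, Nat.add_sub_cancel]
    push_cast
    have e1 : (2 * ((l : ℝ) + 1) + 2) * θ = (2 * ((l : ℝ) + 1) + 1) * θ + θ := by ring
    have e2 : (2 * (l : ℝ) + 2) * θ = (2 * ((l : ℝ) + 1) + 1) * θ - θ := by ring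
    rw [e1, e2, Real.sin_add, Real.sin_sub, pow_succ]
    ring

theorem sinOddMatrix_mul (k : ℕ) :
    sinOddMatrix k * (leMatrixInv k)ᵀ =
      diagonal (fun i => 2 * Real.cos (oddAngle k i)) * sinEvenMatrix k := by
  ext i j
  rw [mul_apply, diagonal_mul]
  have h := sum_leMatrixInv_mul k
    (fun l => (-1) ^ l * Real.sin ((2 * l + 1 : ℕ) * oddAngle k i)) j
  simp only [mul_comm (leMatrixInv k _ _)] at h
  refine Eq.trans h ?_
  rw [sinEvenMatrix, of_apply]
  -- The term missing at the far end would be `sin ((2k+1)θ)`, which vanishes; this boundary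
  -- condition dictates the choice of angles.
  have hlast : (if (j : ℕ) + 1 < k then
      (-1 : ℝ) ^ ((j : ℕ) + 1) * Real.sin ((2 * ((j : ℕ) + 1) + 1 : ℕ) * oddAngle k i) else 0) =
      (-1 : ℝ) ^ ((j : ℕ) + 1) * Real.sin ((2 * ((j : ℕ) + 1) + 1 : ℕ) * oddAngle k i) := by
    split_ifs with hj
    · rfl
    · have e : (2 * ((j : ℕ) + 1) + 1 : ℕ) = 2 * k + 1 := by omega
      rw [e, oddAngle, mul_div_cancel₀ _ (by positivity), Real.sin_nat_mul_pi, mul_zero]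
  rw [hlast]
  set θ := oddAngle k i
  push_cast
  have e1 : (2 * ((j : ℕ) + 1 : ℝ) + 1) * θ = (2 * ((j : ℕ) : ℝ) + 2) * θ + θ := by ring
  have e2 : (2 * ((j : ℕ) : ℝ) + 1) * θ = (2 * ((j : ℕ) : ℝ) + 2) * θ - θ := by ring
  rw [e1, e2, Real.sin_add, Real.sin_sub, pow_succ]
  ring

theorem sinOddMatrix_mul_stepMatrixInv (k : ℕ) :
    sinOddMatrix k * stepMatrixInv k =
      diagonal (fun i => (2 * Real.cos (oddAngle k i)) * (2 * Real.cos (oddAngle k i))) *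
        sinOddMatrix k := by
  rw [stepMatrixInv, ← Matrix.mul_assoc, sinOddMatrix_mul, Matrix.mul_assoc, sinEvenMatrix_mul,
    ← Matrix.mul_assoc, diagonal_mul_diagonal]

theorem oddAngle_pos (k : ℕ) (i : Fin k) : 0 < oddAngle k i := by
  unfold oddAngle
  have := Real.pi_pos
  positivity

theorem oddAngle_lt (k : ℕ) (i : Fin k) : oddAngle k i < Real.pi / 2 := by
  unfold oddAngle
  have := Real.pi_pos
  have h : ((i : ℕ) + 1 : ℝ) ≤ k := by exact_mod_cast i.2
  rw [div_lt_div_iff₀ (by positivity) (by positivity)]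
  push_cast
  nlinarith

theorem oddAngle_injective (k : ℕ) : Function.Injective (oddAngle k) := by
  intro i j h
  unfold oddAngle at h
  rw [div_left_inj' (by positivity), mul_left_inj' Real.pi_ne_zero, Nat.cast_inj] at h
  exact Fin.ext (by omega)

theorem cos_oddAngle_pos (k : ℕ) (i : Fin k) : 0 < Real.cos (oddAngle k i) :=
  Real.cos_pos_of_mem_Ioo ⟨by linarith [oddAngle_pos k i, Real.pi_pos], oddAngle_lt k i⟩

theorem vandermonde_oddAngle_ne_zero (k : ℕ) :
    (vandermonde fun i => (2 * Real.cos (oddAngle k i)) * (2 * Real.cos (oddAngle k i))).det ≠ 0 := by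
  rw [det_vandermonde_ne_zero_iff]
  intro i j h
  have hi := cos_oddAngle_pos k i
  have hj := cos_oddAngle_pos k j
  have h1 : Real.cos (oddAngle k i) = Real.cos (oddAngle k j) := by
    simp only at h
    nlinarith
  refine oddAngle_injective k (Real.injOn_cos ?_ ?_ h1) <;>
  · refine ⟨(oddAngle_pos k _).le, ?_⟩
    have h1 := oddAngle_lt k i
    have h2 := oddAngle_lt k j
    linarith [Real.pi_pos]

theorem prod_sin_mul_oddAngle (k c : ℕ) :
    ∏ i : Fin k, Real.sin (c * oddAngle k i) =
      (if Nat.Coprime c (2 * k + 1) then (-1) ^ (∑ i ∈ Finset.Icc 1 k, i * c / (2 * k + 1)) else 0) *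
        ∏ i : Fin k, Real.sin (oddAngle k i) := by
  have hconv : ∀ g : ℕ → ℝ, ∏ i ∈ Finset.Icc 1 k, g i = ∏ i : Fin k, g (i + 1) := by
    intro g
    rw [Fin.prod_univ_eq_prod_range (fun i => g (i + 1)), Finset.range_eq_Ico,
      Finset.prod_Ico_add' g 0 k 1]
    rfl
  have h1 : ∏ i : Fin k, Real.sin (c * oddAngle k i) =
      ∏ i ∈ Finset.Icc 1 k, Real.sin ((i * c : ℕ) * Real.pi / (2 * k + 1 : ℕ)) := by
    rw [hconv]
    refine Finset.prod_congr rfl fun i _ => ?_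
    congr 1
    unfold oddAngle
    push_cast
    ring
  have h2 : ∏ i : Fin k, Real.sin (oddAngle k i) =
      ∏ i ∈ Finset.Icc 1 k, Real.sin (i * Real.pi / (2 * k + 1 : ℕ)) := by
    rw [hconv]
    rfl
  rw [h1, h2]
  split_ifs with h
  · exact prod_sin_mul_of_coprime k c h
  · rw [zero_mul]
    exact prod_sin_mul_of_not_coprime k c h

theorem prod_sin_oddAngle_ne_zero (k : ℕ) : ∏ i : Fin k, Real.sin (oddAngle k i) ≠ 0 := by
  refine Finset.prod_ne_zero_iff.mpr fun i _ => ne_of_gt ?_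
  exact Real.sin_pos_of_pos_of_lt_pi (oddAngle_pos k i)
    (by linarith [oddAngle_lt k i, Real.pi_pos])

theorem prod_two_mul_cos_oddAngle (k : ℕ) : ∏ i : Fin k, (2 * Real.cos (oddAngle k i)) = 1 := by
  -- With multiplier `2` no angle `2iπ/(2k+1)` reaches `π`, so all floors are zero; then the
  -- double-angle formula gives the cosines.
  have h := prod_sin_mul_oddAngle k 2
  rw [if_pos (by simp), Finset.sum_eq_zero, pow_zero, one_mul] at h
  · simp only [Nat.cast_ofNat, Real.sin_two_mul] at h
    refine mul_right_cancel₀ (prod_sin_oddAngle_ne_zero k) ?_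
    rw [one_mul, ← Finset.prod_mul_distrib]
    refine Eq.trans (Finset.prod_congr rfl fun i _ => ?_) h
    ring
  · intro i hi
    rw [Finset.mem_Icc] at hi
    exact Nat.div_eq_of_lt (by omega)

/-- The sign `(-1) ^ ∑ ⌊i c / (2k+1)⌋` of the product of the `sin (c π i / (2k+1))`, or zero if that
product vanishes. -/
noncomputable def floorSign (k c : ℕ) : ℝ :=
  if Nat.Coprime c (2 * k + 1) then (-1) ^ (∑ i ∈ Finset.Icc 1 k, i * c / (2 * k + 1)) else 0

theorem det_sinOddMatrix_mul_krylov (k : ℕ) (v : Fin k → ℝ) (hk : 0 < k) (a : ℝ)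
    (hv : ∏ i, (sinOddMatrix k *ᵥ v) i = a * ∏ i : Fin k, Real.sin (oddAngle k i)) :
    (krylov (stepMatrixInv k) v).det =
      a * (krylov (stepMatrixInv k) (Pi.single ⟨0, hk⟩ 1)).det := by
  have h0 : ∏ i, (sinOddMatrix k *ᵥ Pi.single ⟨0, hk⟩ 1) i = ∏ i : Fin k, Real.sin (oddAngle k i) := by
    refine Finset.prod_congr rfl fun i _ => ?_
    rw [mulVec_single_one]
    simp [sinOddMatrix]
  have hV := vandermonde_oddAngle_ne_zero k
  have hS := prod_sin_oddAngle_ne_zero k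
  have e1 := det_krylov_mul (stepMatrixInv k) (sinOddMatrix k) _
    (sinOddMatrix_mul_stepMatrixInv k) v
  have e0 := det_krylov_mul (stepMatrixInv k) (sinOddMatrix k) _
    (sinOddMatrix_mul_stepMatrixInv k) (Pi.single ⟨0, hk⟩ 1)
  rw [hv] at e1
  rw [h0] at e0
  -- Invertibility of the eigenvector matrix comes for free: for the first unit vector the other
  -- side is a product of non-zero sines times a non-zero Vandermonde determinant.
  have hW : (sinOddMatrix k).det ≠ 0 := by
    intro h
    rw [h, zero_mul] at e0
    exact mul_ne_zero hS hV e0.symm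
  refine mul_left_cancel₀ hW ?_
  rw [e1]
  linear_combination -a * e0

theorem det_krylov_single (k : ℕ) (r : Fin k) (hk : 0 < k) :
    (krylov (stepMatrixInv k) (Pi.single r 1)).det =
      ((-1) ^ (k * r) * floorSign k (2 * r + 1)) *
        (krylov (stepMatrixInv k) (Pi.single ⟨0, hk⟩ 1)).det := by
  refine det_sinOddMatrix_mul_krylov k _ hk _ ?_
  rw [floorSign, mul_assoc, ← prod_sin_mul_oddAngle, mul_comm k, pow_mul]
  simp [sinOddMatrix, Finset.prod_mul_distrib]

/-- The factor `(leMatrixInv k)ᵀ` replaces odd multiples of the angle by even ones, at the cost of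
factors `2 cos θ` whose product is one. -/
theorem det_krylov_inv_single (k : ℕ) (s : Fin k) (hk : 0 < k) :
    (krylov (stepMatrixInv k) ((leMatrixInv k)ᵀ *ᵥ Pi.single s 1)).det =
      ((-1) ^ (k * s) * floorSign k (2 * s + 2)) *
        (krylov (stepMatrixInv k) (Pi.single ⟨0, hk⟩ 1)).det := by
  refine det_sinOddMatrix_mul_krylov k _ hk _ ?_
  have h : ∀ i, (sinOddMatrix k *ᵥ ((leMatrixInv k)ᵀ *ᵥ Pi.single s 1)) i =
      (2 * Real.cos (oddAngle k i)) *
        ((-1) ^ (s : ℕ) * Real.sin ((2 * (s : ℕ) + 2 : ℕ) * oddAngle k i)) := by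
    intro i
    rw [mulVec_mulVec, sinOddMatrix_mul, ← mulVec_mulVec, mulVec_diagonal, mulVec_single_one]
    rfl
  rw [Finset.prod_congr rfl fun i _ => h i, Finset.prod_mul_distrib, prod_two_mul_cos_oddAngle,
    one_mul, floorSign, mul_assoc, ← prod_sin_mul_oddAngle, mul_comm k, pow_mul]
  simp [Finset.prod_mul_distrib]

/-! ### Counts of alternating sequences as matrix entries, and the extension to length zero. -/

theorem det_hankel_stepMatrix_pow (k m : ℕ) (r s : Fin k) :
    (of fun i j : Fin k => (stepMatrix ℝ k ^ (m + i + j)) r s).det =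
      (-1) ^ (k * (r + s)) * (floorSign k (2 * r + 1) * floorSign k (2 * s + 1)) := by
  have hk : 0 < k := r.pos
  have h := det_hankel_stepMatrix k m (Pi.single r 1) (Pi.single s 1)
  rw [det_krylov_single k r hk, det_krylov_single k s hk] at h
  simp only [single_one_dotProduct, mulVec_single_one] at h
  refine h.trans ?_
  have hD := det_krylov_single_zero k hk
  rw [mul_add, pow_add]
  linear_combination (-1) ^ (k * (r : ℕ)) * floorSign k (2 * r + 1) * ((-1) ^ (k * (s : ℕ)) *
    floorSign k (2 * s + 1)) * hD

theorem det_hankel_stepMatrix_pow_mul (k m : ℕ) (r s : Fin k) :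
    (of fun i j : Fin k => (stepMatrix ℝ k ^ (m + i + j) * (leMatrixInv k)ᵀ) r s).det =
      (-1) ^ (k * (r + s)) * (floorSign k (2 * r + 1) * floorSign k (2 * s + 2)) := by
  have hk : 0 < k := r.pos
  have h := det_hankel_stepMatrix k m (Pi.single r 1) ((leMatrixInv k)ᵀ *ᵥ Pi.single s 1)
  rw [det_krylov_single k r hk, det_krylov_inv_single k s hk] at h
  simp only [single_one_dotProduct, mulVec_mulVec] at h
  simp only [mulVec_single_one] at h
  refine h.trans ?_
  have hD := det_krylov_single_zero k hk
  rw [mul_add, pow_add]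
  linear_combination (-1) ^ (k * (r : ℕ)) * floorSign k (2 * r + 1) * ((-1) ^ (k * (s : ℕ)) *
    floorSign k (2 * s + 2)) * hD

theorem altNum_eq_stepMatrix_pow (k m : ℕ) (r s : Fin k) :
    (altNum k (2 * m + 1) (r + 1) (s + 1) : ℝ) = (stepMatrix ℝ k ^ m) r s ∧
    (altNum k (2 * m + 2) (r + 1) (s + 1) : ℝ) = (stepMatrix ℝ k ^ m * leMatrix ℝ k) r s := by
  have hconv : ∀ g : ℕ → ℝ, ∑ i ∈ Finset.Icc 1 k, g i = ∑ i : Fin k, g (i + 1) := by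
    intro g
    rw [Fin.sum_univ_eq_sum_range (fun i => g (i + 1)), Finset.range_eq_Ico,
      Finset.sum_Ico_add' g 0 k 1]
    rfl
  have hstep : ∀ n : ℕ, ∀ s : Fin k, (altNum k (n + 2) (r + 1) (s + 1) : ℝ) =
      ∑ l : Fin k, (altNum k (n + 1) (r + 1) (l + 1) : ℝ) *
        (if Even n then leMatrix ℝ k else (leMatrix ℝ k)ᵀ) l s := by
    intro n s
    rw [altNum_add_two k n _ _ (by omega) (by have := s.2; omega), Nat.cast_sum, hconv]
    refine Finset.sum_congr rfl fun l _ => ?_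
    have hle : ∀ a b : Fin k, leMatrix ℝ k a b = if (a : ℕ) + 1 ≤ b + 1 then 1 else 0 := by
      intro a b
      simp only [leMatrix, of_apply, Fin.le_def, add_le_add_iff_right]
    by_cases hn : Even n
    · simp only [if_pos hn, hle, mul_ite, mul_one, mul_zero, Nat.cast_ite, Nat.cast_zero]
    · simp only [if_neg hn, transpose_apply, hle, mul_ite, mul_one, mul_zero, Nat.cast_ite,
        Nat.cast_zero]
  have heven : ∀ m : ℕ,
      (∀ s : Fin k, (altNum k (2 * m + 1) (r + 1) (s + 1) : ℝ) = (stepMatrix ℝ k ^ m) r s) →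
      ∀ s : Fin k, (altNum k (2 * m + 2) (r + 1) (s + 1) : ℝ) =
        (stepMatrix ℝ k ^ m * leMatrix ℝ k) r s := by
    intro m h s
    rw [hstep, if_pos (even_two_mul m), mul_apply]
    exact Finset.sum_congr rfl fun l _ => by rw [h]
  have main : ∀ m : ℕ, ∀ s : Fin k,
      (altNum k (2 * m + 1) (r + 1) (s + 1) : ℝ) = (stepMatrix ℝ k ^ m) r s := by
    intro m
    induction m with
    | zero =>
      intro s
      rw [Nat.mul_zero, Nat.zero_add, altNum_one _ _ _ (by omega) (by have := r.2; omega), pow_zero,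
        one_apply]
      simp [Fin.ext_iff]
    | succ m ih =>
      intro s
      rw [show 2 * (m + 1) + 1 = (2 * m + 1) + 2 by ring, hstep,
        if_neg (by simp), pow_succ, stepMatrix, ← Matrix.mul_assoc, mul_apply]
      exact Finset.sum_congr rfl fun l _ => by rw [heven m ih l]; rfl
  exact ⟨main m s, heven m (main m) s⟩

theorem altNum_even_eq (k m : ℕ) (r s : Fin k) :
    (altNum k (2 * m + 2) (r + 1) (s + 1) : ℝ) =
      (stepMatrix ℝ k ^ (m + 1) * (leMatrixInv k)ᵀ) r s := by
  rw [(altNum_eq_stepMatrix_pow k m r s).2, pow_succ, Matrix.mul_assoc,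
    stepMatrix_mul_inv_transpose]

theorem leMatrix_map (k : ℕ) : (leMatrix ℚ k).map (algebraMap ℚ ℝ) = leMatrix ℝ k := by
  ext i j
  simp only [leMatrix, map_apply, of_apply]
  split_ifs <;> simp

theorem stepMatrix_map (k : ℕ) : (stepMatrix ℚ k).map (algebraMap ℚ ℝ) = stepMatrix ℝ k := by
  rw [stepMatrix, stepMatrix, Matrix.map_mul, ← leMatrix_map, transpose_map]

theorem stepMatrix_charpoly_coeff_zero (k : ℕ) : (stepMatrix ℚ k).charpoly.coeff 0 ≠ 0 := by
  have h : algebraMap ℚ ℝ (stepMatrix ℚ k).det = 1 := by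
    rw [RingHom.map_det, RingHom.mapMatrix_apply, stepMatrix_map, det_stepMatrix]
  intro h0
  rw [Matrix.det_eq_sign_charpoly_coeff, h0, mul_zero, map_zero] at h
  exact zero_ne_one h

/-- Cayley–Hamilton, with the characteristic polynomial taken over `ℚ` so that the recurrence has
rational coefficients. -/
theorem stepMatrix_recurrence (k : ℕ) (u : ℕ → ℚ) (C : Matrix (Fin k) (Fin k) ℝ) (r s : Fin k)
    (hu : ∀ n, (u n : ℝ) = (stepMatrix ℝ k ^ n * C) r s) (n : ℕ) :
    ∑ i ∈ Finset.range ((stepMatrix ℚ k).charpoly.natDegree + 1),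
      (stepMatrix ℚ k).charpoly.coeff i * u (n + i) = 0 := by
  have hch : Polynomial.aeval (stepMatrix ℝ k) ((stepMatrix ℚ k).charpoly.map (algebraMap ℚ ℝ)) = 0 := by
    rw [← Matrix.charpoly_map, stepMatrix_map]
    exact Matrix.aeval_self_charpoly _
  rw [Polynomial.aeval_eq_sum_range' (n := (stepMatrix ℚ k).charpoly.natDegree + 1)
    (lt_of_le_of_lt Polynomial.natDegree_map_le (Nat.lt_succ_self _))] at hch
  have h1 : stepMatrix ℝ k ^ n * (∑ i ∈ Finset.range ((stepMatrix ℚ k).charpoly.natDegree + 1),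
      ((stepMatrix ℚ k).charpoly.map (algebraMap ℚ ℝ)).coeff i • stepMatrix ℝ k ^ i) * C = 0 := by
    rw [hch, mul_zero, zero_mul]
  rw [Finset.mul_sum, Finset.sum_mul] at h1
  have h2 := congrFun (congrFun h1 r) s
  rw [Matrix.sum_apply] at h2
  have h3 : ((∑ i ∈ Finset.range ((stepMatrix ℚ k).charpoly.natDegree + 1),
      (stepMatrix ℚ k).charpoly.coeff i * u (n + i) : ℚ) : ℝ) = 0 := by
    rw [Rat.cast_sum]
    refine Eq.trans (Finset.sum_congr rfl fun i _ => ?_) h2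
    rw [Rat.cast_mul, hu, pow_add, Matrix.mul_smul, Matrix.smul_mul, Matrix.smul_apply,
      Polynomial.coeff_map, eq_ratCast, smul_eq_mul]
  exact_mod_cast h3

/-- The extension of the numbers of alternating sequences of even length. -/
theorem altNum_even_extension (k : ℕ) (r s : Fin k) :
    (∃! b : ℤ → ℚ, IsRecurrenceExtension
      (fun m => (altNum k (2 * m + 2) (r + 1) (s + 1) : ℚ)) b) ∧
    ∀ b : ℤ → ℚ, IsRecurrenceExtension (fun m => (altNum k (2 * m + 2) (r + 1) (s + 1) : ℚ)) b →
      ∀ n : ℕ, (b (n - 1) : ℝ) = (stepMatrix ℝ k ^ n * (leMatrixInv k)ᵀ) r s := by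
  have hex := existsUnique_recurrenceExtension
    (fun m => (altNum k (2 * m + 2) (r + 1) (s + 1) : ℚ)) (stepMatrix ℚ k).charpoly
    (stepMatrix_charpoly_coeff_zero k)
    (stepMatrix_recurrence k _ (leMatrix ℝ k) r s
      (fun n => by rw [← (altNum_eq_stepMatrix_pow k n r s).2]; norm_cast))
  refine ⟨hex, fun b hb n => ?_⟩
  obtain ⟨q, hq⟩ : ∃ q : ℚ, (q : ℝ) = (leMatrixInv k)ᵀ r s := by
    simp only [leMatrixInv, transpose_apply, of_apply]
    split_ifs
    exacts [⟨1, by simp⟩, ⟨-1, by simp⟩, ⟨0, by simp⟩]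
  -- Prepending the candidate value for length zero gives a sequence with the same recurrence. Its
  -- extension, shifted by one, must be `b` by uniqueness.
  let u : ℕ → ℚ := fun n => if n = 0 then q else altNum k (2 * n) (r + 1) (s + 1)
  have hu : ∀ n, (u n : ℝ) = (stepMatrix ℝ k ^ n * (leMatrixInv k)ᵀ) r s := by
    intro n
    cases n with
    | zero => simp [u, hq]
    | succ n =>
      rw [← altNum_even_eq]
      simp [u, mul_add]
  obtain ⟨b', hb', hr'⟩ := exists_recurrenceExtension u (stepMatrix ℚ k).charpoly
    (stepMatrix_charpoly_coeff_zero k) (stepMatrix_recurrence k u (leMatrixInv k)ᵀ r s hu)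
  obtain ⟨hb1, d, c, hc0, -, hr⟩ := hb
  have heq : b = fun m => b' (m + 1) := by
    refine recurrence_unique b _ d (stepMatrix ℚ k).charpoly.natDegree c
      (stepMatrix ℚ k).charpoly.coeff hc0 (stepMatrix_charpoly_coeff_zero k) hr
      (fun m => ?_) (fun n => ?_)
    · rw [← hr' (m + 1)]
      refine Finset.sum_congr rfl fun i _ => ?_
      congr 2
      ring
    · have h1 := hb' (n + 1)
      push_cast at h1
      simp only [hb1, h1]
      simp [u, mul_add]
  rw [heq]
  simp only [sub_add_cancel]
  rw [hb', hu]

/-! ### Exponential sums at negative indices. -/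

/-- The derivative at a node is the product of the differences to all other nodes. Over all nodes
every pair occurs twice, with opposite signs, which accounts for `d(d-1)/2` sign changes. -/
theorem det_vandermonde_sq {d : ℕ} (x : Fin d → ℝ) :
    ∏ l, (Polynomial.derivative (Lagrange.nodal Finset.univ x)).eval (x l) =
      (-1) ^ (d * (d - 1) / 2) * (vandermonde x).det ^ 2 := by
  have h1 : ∀ l, (Polynomial.derivative (Lagrange.nodal Finset.univ x)).eval (x l) =
      (∏ j ∈ Finset.Ioi l, (x l - x j)) * ∏ j ∈ Finset.Iio l, (x l - x j) := by
    intro l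
    rw [Lagrange.eval_nodal_derivative_eval_node_eq (Finset.mem_univ l), Lagrange.eval_nodal,
      ← Finset.prod_union]
    · refine Finset.prod_congr ?_ fun _ _ => rfl
      ext j
      simp only [Finset.mem_erase, Finset.mem_univ, and_true, Finset.mem_union, Finset.mem_Ioi,
        Finset.mem_Iio]
      exact ⟨fun h => (lt_or_gt_of_ne h).symm, fun h => h.elim (fun h => h.ne') fun h => h.ne⟩
    · rw [Finset.disjoint_left]
      intro j hj hj'
      exact lt_asymm (Finset.mem_Ioi.mp hj) (Finset.mem_Iio.mp hj')
  have h2 : ∏ l, ∏ j ∈ Finset.Iio l, (x l - x j) = (vandermonde x).det := by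
    rw [det_vandermonde]
    refine Finset.prod_comm' fun a b => ?_
    simp
  have h3 : ∏ l, ∏ j ∈ Finset.Ioi l, (x l - x j) =
      (-1) ^ (d * (d - 1) / 2) * (vandermonde x).det := by
    have h4 : ∀ l : Fin d, ∏ j ∈ Finset.Ioi l, (x l - x j) =
        (-1) ^ (d - 1 - (l : ℕ)) * ∏ j ∈ Finset.Ioi l, (x j - x l) := by
      intro l
      rw [← Fin.card_Ioi, ← Finset.prod_const, ← Finset.prod_mul_distrib]
      exact Finset.prod_congr rfl fun j _ => by ring
    rw [Finset.prod_congr rfl fun l _ => h4 l, Finset.prod_mul_distrib, det_vandermonde,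
      Finset.prod_pow_eq_pow_sum, Fin.sum_univ_eq_sum_range (fun l => d - 1 - l),
      Finset.sum_range_reflect (fun l => l), Finset.sum_range_id]
  rw [Finset.prod_congr rfl fun l _ => h1 l, Finset.prod_mul_distrib, h2, h3]
  ring

theorem det_hankel_exponential_sum {d : ℕ} (x w : Fin d → ℝ) (hx : ∀ l, x l ≠ 0) (n : ℕ) :
    (of fun i j : Fin d => ∑ l, w l * x l ^ (-(n : ℤ) - (i : ℕ) - (j : ℕ))).det =
      (∏ l, w l) * (∏ l, x l) ^ (-((n : ℤ) + 2 * ((d : ℤ) - 1))) * (vandermonde x).det ^ 2 := by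
  rw [← det_submatrix_equiv_self Fin.revPerm]
  -- After reversal the exponents increase with `i` and `j`; the lowest one, `-(n + 2(d-1))`, is
  -- absorbed into the diagonal between two Vandermonde matrices.
  have h : (of fun i j : Fin d => ∑ l, w l * x l ^ (-(n : ℤ) - (i : ℕ) - (j : ℕ))).submatrix
      Fin.revPerm Fin.revPerm = (vandermonde x)ᵀ *
        (diagonal (fun l => w l * x l ^ (-((n : ℤ) + 2 * ((d : ℤ) - 1)))) * vandermonde x) := by
    ext i j
    rw [mul_apply]
    simp only [submatrix_apply, of_apply, Fin.revPerm_apply, transpose_apply, diagonal_mul,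
      vandermonde_apply]
    refine Finset.sum_congr rfl fun l _ => ?_
    have hi := Fin.val_rev i
    have hj := Fin.val_rev j
    have e : -(n : ℤ) - (i.rev : ℕ) - (j.rev : ℕ) =
        (i : ℕ) + (-((n : ℤ) + 2 * ((d : ℤ) - 1)) + (j : ℕ)) := by
      have := i.2
      have := j.2
      omega
    rw [e, zpow_add₀ (hx l), zpow_add₀ (hx l), zpow_natCast, zpow_natCast]
    ring
  rw [h, det_mul, det_mul, det_transpose, det_diagonal, Finset.prod_mul_distrib, Finset.prod_zpow]
  ring

-- Since `p` vanishes at every node, the real exponential sum obeys its recurrence at all integers.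
-- Uniqueness over `ℝ` identifies it with any rational extension.
open Polynomial in
theorem exponential_sum_extension {d : ℕ} (x w : Fin d → ℝ) (hx : ∀ l, x l ≠ 0) (p : ℚ[X])
    (hp : p.map (algebraMap ℚ ℝ) = Lagrange.nodal Finset.univ x) (u : ℕ → ℚ)
    (hu : ∀ n, (u n : ℝ) = ∑ l, w l * x l ^ n) :
    (∃! b : ℤ → ℚ, IsRecurrenceExtension u b) ∧
    ∀ b : ℤ → ℚ, IsRecurrenceExtension u b → ∀ m : ℤ, (b m : ℝ) = ∑ l, w l * x l ^ m := by
  have hroot : ∀ l, ∑ i ∈ Finset.range (p.natDegree + 1), (p.coeff i : ℝ) * x l ^ i = 0 := by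
    intro l
    have h : (p.map (algebraMap ℚ ℝ)).eval (x l) = 0 := by
      rw [hp, Lagrange.eval_nodal_at_node (Finset.mem_univ l)]
    rw [eval_map, eval₂_eq_sum_range] at h
    simpa using h
  have hp0 : p.coeff 0 ≠ 0 := by
    intro h
    have h1 : (p.map (algebraMap ℚ ℝ)).eval 0 = 0 := by
      rw [← coeff_zero_eq_eval_zero, coeff_map, h, map_zero]
    rw [hp, Lagrange.eval_nodal, Finset.prod_eq_zero_iff] at h1
    obtain ⟨l, -, hl⟩ := h1
    exact hx l (by linarith)
  have hsum : ∀ m : ℤ, ∑ i ∈ Finset.range (p.natDegree + 1),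
      (p.coeff i : ℝ) * ∑ l, w l * x l ^ (m + i) = 0 := by
    intro m
    simp only [Finset.mul_sum]
    rw [Finset.sum_comm]
    refine Finset.sum_eq_zero fun l _ => ?_
    have h := hroot l
    have h2 : ∀ i : ℕ, (p.coeff i : ℝ) * (w l * x l ^ (m + i)) =
        (w l * x l ^ m) * (p.coeff i * x l ^ i) := by
      intro i
      rw [zpow_add₀ (hx l), zpow_natCast]
      ring
    rw [Finset.sum_congr rfl fun i _ => h2 i, ← Finset.mul_sum, h, mul_zero]
  constructor
  · refine existsUnique_recurrenceExtension u p hp0 fun n => ?_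
    have h := hsum n
    have h2 : ((∑ i ∈ Finset.range (p.natDegree + 1), p.coeff i * u (n + i) : ℚ) : ℝ) = 0 := by
      rw [← h, Rat.cast_sum]
      refine Finset.sum_congr rfl fun i _ => ?_
      rw [Rat.cast_mul, hu]
      norm_cast
    exact_mod_cast h2
  · rintro b ⟨hb, e, c, hc, -, hr⟩ m
    have h := recurrence_unique (fun m => (b m : ℝ)) (fun m => ∑ l, w l * x l ^ m) e p.natDegree
      (fun i => (c i : ℝ)) (fun i => (p.coeff i : ℝ)) (by exact_mod_cast hc)
      (by exact_mod_cast hp0) (fun m => by exact_mod_cast hr m) hsum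
      (fun n => by simp [hb, hu])
    exact congrFun h m

/-! ### Trigonometric formula for the path counts. -/

/-- The angles `π/(2q), 3π/(2q), …, (2q-1)π/(2q)`. -/
noncomputable def chebAngle (q i : ℕ) : ℝ := (2 * (i : ℝ) + 1) / (2 * q) * Real.pi

theorem chebAngle_pos (q i : ℕ) (hi : i < q) : 0 < chebAngle q i := by
  have := Real.pi_pos
  have : (0 : ℝ) < q := by exact_mod_cast (by omega : 0 < q)
  unfold chebAngle
  positivity

theorem chebAngle_rev (q i : ℕ) (hi : i < q) :
    chebAngle q (q - 1 - i) = Real.pi - chebAngle q i := by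
  have : (q : ℝ) ≠ 0 := by exact_mod_cast (by omega : q ≠ 0)
  unfold chebAngle
  rw [Nat.sub_sub, Nat.cast_sub (by omega)]
  push_cast
  field_simp
  ring

theorem chebAngle_lt_pi (q i : ℕ) (hi : i < q) : chebAngle q i < Real.pi := by
  have := chebAngle_pos q (q - 1 - i) (by omega)
  rw [chebAngle_rev q i hi] at this
  linarith

theorem sin_chebAngle_pos (q i : ℕ) (hi : i < q) : 0 < Real.sin (chebAngle q i) :=
  Real.sin_pos_of_pos_of_lt_pi (chebAngle_pos q i hi) (chebAngle_lt_pi q i hi)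

theorem sin_mul_chebAngle (q i : ℕ) (hi : i < q) : Real.sin (q * chebAngle q i) = (-1) ^ i := by
  have : (q : ℝ) ≠ 0 := by exact_mod_cast (by omega : q ≠ 0)
  have e : q * chebAngle q i = Real.pi / 2 + i * Real.pi := by
    unfold chebAngle
    field_simp
    ring
  rw [e, Real.sin_add_nat_mul_pi, Real.sin_pi_div_two, mul_one]

theorem cos_mul_chebAngle (q i : ℕ) (hi : i < q) : Real.cos (q * chebAngle q i) = 0 := by
  have h := Real.sin_sq_add_cos_sq (q * chebAngle q i)
  rw [sin_mul_chebAngle q i hi, ← pow_mul, mul_comm, pow_mul] at h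
  simpa using h

theorem sum_cos_mul_chebAngle (q t : ℕ) (ht : 0 < t) (htq : t < 2 * q) :
    ∑ i ∈ Finset.range q, Real.cos (t * chebAngle q i) = 0 := by
  have hd : ¬ (2 * (q : ℤ)) ∣ (t : ℤ) := by
    intro h
    have := Int.le_of_dvd (by omega) h
    omega
  have h := Polynomial.Chebyshev.sumZeroes_T_of_not_dvd hd
  have hq : (q : ℝ) ≠ 0 := by exact_mod_cast (by omega : q ≠ 0)
  rw [Polynomial.Chebyshev.sumZeroes, mul_eq_zero] at h
  rcases h with h | h
  · exact absurd h (div_ne_zero Real.pi_ne_zero hq)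
  · rw [← h]
    refine Finset.sum_congr rfl fun i _ => ?_
    rw [Polynomial.Chebyshev.T_real_cos]
    rfl

/-- The weight of the eigenvalue `2 cos ψ` in the number of paths starting at height `r`. -/
noncomputable def pathWeight (r : ℕ) (ψ : ℝ) : ℝ :=
  Real.sin ((r + 1) * ψ) * (1 + Real.cos ψ) / Real.sin ψ

theorem pathWeight_zero {ψ : ℝ} (h : Real.sin ψ ≠ 0) : pathWeight 0 ψ = 1 + Real.cos ψ := by
  unfold pathWeight
  simp only [Nat.cast_zero, zero_add, one_mul]
  field_simp

theorem pathWeight_succ {ψ : ℝ} (h : Real.sin ψ ≠ 0) (r : ℕ) :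
    pathWeight (r + 1) ψ = pathWeight r ψ +
      (Real.cos ((r + 2 : ℕ) * ψ) + Real.cos ((r + 1 : ℕ) * ψ)) := by
  unfold pathWeight
  push_cast
  have e1 : ((r : ℝ) + 1 + 1) * ψ = (r + 1) * ψ + ψ := by ring
  have e2 : ((r : ℝ) + 2) * ψ = (r + 1) * ψ + ψ := by ring
  rw [e1, e2, Real.sin_add, Real.cos_add, div_eq_iff h]
  have h1 := div_mul_cancel₀ (Real.sin ((r + 1) * ψ) * (1 + Real.cos ψ)) h
  linear_combination Real.sin ((r + 1) * ψ) * Real.sin_sq_add_cos_sq ψ - h1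

theorem pathWeight_add {ψ : ℝ} (r : ℕ) :
    pathWeight (r + 2) ψ + pathWeight r ψ = pathWeight (r + 1) ψ * (2 * Real.cos ψ) := by
  unfold pathWeight
  push_cast
  have e1 : ((r : ℝ) + 2 + 1) * ψ = (r + 1 + 1) * ψ + ψ := by ring
  have e2 : ((r : ℝ) + 1) * ψ = (r + 1 + 1) * ψ - ψ := by ring
  rw [e1, e2, Real.sin_add, Real.sin_sub]
  ring

theorem pathWeight_one {ψ : ℝ} : pathWeight 1 ψ = pathWeight 0 ψ * (2 * Real.cos ψ) := by
  unfold pathWeight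
  push_cast
  have e1 : ((1 : ℝ) + 1) * ψ = 2 * ψ := by ring
  rw [e1, Real.sin_two_mul]
  simp only [zero_add, one_mul]
  ring

/-- This is the formula at length zero. Raising `r` by one adds cosine sums of frequency below `2q`,
which vanish. -/
theorem sum_pathWeight (q r : ℕ) (hr : r + 2 ≤ 2 * q) :
    ∑ i ∈ Finset.range q, pathWeight r (chebAngle q i) = q := by
  induction r with
  | zero =>
    have h := sum_cos_mul_chebAngle q 1 one_pos (by omega)
    simp only [Nat.cast_one, one_mul] at h
    rw [Finset.sum_congr rfl fun i hi =>
      pathWeight_zero (sin_chebAngle_pos q i (Finset.mem_range.mp hi)).ne',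
      Finset.sum_add_distrib, h]
    simp
  | succ r ih =>
    rw [Finset.sum_congr rfl fun i hi =>
      pathWeight_succ (sin_chebAngle_pos q i (Finset.mem_range.mp hi)).ne' r,
      Finset.sum_add_distrib, Finset.sum_add_distrib, ih (by omega),
      sum_cos_mul_chebAngle q _ (by omega) (by omega),
      sum_cos_mul_chebAngle q _ (by omega) (by omega)]
    simp

/-- Upper boundary condition: the height just above the strip carries no weight, so forbidding the
up-step at the top is consistent with the recursion. -/
theorem pathWeight_top (q i : ℕ) (hi : i < q) : pathWeight (2 * q - 1) (chebAngle q i) = 0 := by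
  unfold pathWeight
  have e : (((2 * q - 1 : ℕ) : ℝ) + 1) * chebAngle q i = 2 * (q * chebAngle q i) := by
    rw [Nat.cast_sub (by omega)]
    push_cast
    ring
  rw [e, Real.sin_two_mul, cos_mul_chebAngle q i hi]
  simp

/-- The number of paths of length `n` starting at height `r` in the strip of height `2q - 2`. -/
theorem sum_pathNum_eq (q n r : ℕ) (hr : r + 2 ≤ 2 * q) :
    ((∑ s ∈ Finset.range (2 * q - 2 + 1), pathNum (2 * q - 2) n r s : ℕ) : ℝ) =
      (∑ i ∈ Finset.range q, pathWeight r (chebAngle q i) * (2 * Real.cos (chebAngle q i)) ^ n) / q := by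
  have hq : (q : ℝ) ≠ 0 := by exact_mod_cast (by omega : q ≠ 0)
  induction n generalizing r with
  | zero =>
    simp only [pow_zero, mul_one]
    rw [sum_pathWeight q r hr, div_self hq,
      Finset.sum_congr rfl fun s _ => pathNum_zero (2 * q - 2) r s (by omega), Finset.sum_ite_eq,
      if_pos (by rw [Finset.mem_range]; omega), Nat.cast_one]
  | succ n ih =>
    rw [Finset.sum_congr rfl fun s _ => pathNum_succ (2 * q - 2) n r s (by omega),
      Finset.sum_add_distrib, Nat.cast_add]
    have hup : ((∑ s ∈ Finset.range (2 * q - 2 + 1),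
        (if r < 2 * q - 2 then pathNum (2 * q - 2) n (r + 1) s else 0) : ℕ) : ℝ) =
        (∑ i ∈ Finset.range q,
          pathWeight (r + 1) (chebAngle q i) * (2 * Real.cos (chebAngle q i)) ^ n) / q := by
      by_cases h : r < 2 * q - 2
      · simp only [if_pos h]
        exact ih (r + 1) (by omega)
      · simp only [if_neg h]
        rw [Finset.sum_eq_zero fun s _ => rfl, Nat.cast_zero, Finset.sum_eq_zero, zero_div]
        intro i hi
        rw [show r + 1 = 2 * q - 1 by omega, pathWeight_top q i (Finset.mem_range.mp hi), zero_mul]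
    rw [hup]
    rcases Nat.eq_zero_or_pos r with rfl | h0
    · simp only [lt_irrefl, if_false, Finset.sum_const_zero, Nat.cast_zero, add_zero, zero_add]
      congr 1
      refine Finset.sum_congr rfl fun i _ => ?_
      rw [pathWeight_one, pow_succ]
      ring
    · obtain ⟨t, rfl⟩ : ∃ t, r = t + 1 := ⟨r - 1, by omega⟩
      simp only [if_pos h0, Nat.add_sub_cancel]
      rw [ih t (by omega), ← add_div, ← Finset.sum_add_distrib]
      congr 1
      refine Finset.sum_congr rfl fun i _ => ?_
      rw [← add_mul, pathWeight_add, pow_succ]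
      ring

theorem pathSum_eq (q n : ℕ) (hq : 0 < q) :
    (pathSum n (2 * q - 2) : ℝ) =
      ∑ i : Fin q, (1 + Real.cos (chebAngle q i)) / q * (2 * Real.cos (chebAngle q i)) ^ n := by
  rw [pathSum, sum_pathNum_eq q n 0 (by omega), Finset.sum_div, ← Fin.sum_univ_eq_sum_range
    (fun i => pathWeight 0 (chebAngle q i) * (2 * Real.cos (chebAngle q i)) ^ n / q)]
  refine Finset.sum_congr rfl fun i _ => ?_
  rw [pathWeight_zero (sin_chebAngle_pos q i i.2).ne']
  ring

/-- The reflection `ψ ↦ π - ψ` permutes the angles, so the product also equals `∏ (1 - cos ψ)`;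
multiplying the two gives `∏ sin² ψ`, and both sides are non-negative. -/
theorem prod_one_add_cos_chebAngle (q : ℕ) :
    ∏ i : Fin q, (1 + Real.cos (chebAngle q i)) = ∏ i : Fin q, Real.sin (chebAngle q i) := by
  have hrev : ∏ i : Fin q, (1 + Real.cos (chebAngle q i)) =
      ∏ i : Fin q, (1 - Real.cos (chebAngle q i)) := by
    rw [← Equiv.prod_comp Fin.revPerm]
    refine Finset.prod_congr rfl fun i _ => ?_
    have e : ((Fin.revPerm i : Fin q) : ℕ) = q - 1 - i := by
      rw [Fin.revPerm_apply, Fin.val_rev]; omega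
    rw [e, chebAngle_rev q i i.2, Real.cos_pi_sub, sub_eq_add_neg]
  have hsq : (∏ i : Fin q, (1 + Real.cos (chebAngle q i))) ^ 2 =
      (∏ i : Fin q, Real.sin (chebAngle q i)) ^ 2 := by
    conv_lhs => rw [sq]
    conv_lhs => rhs; rw [hrev]
    rw [← Finset.prod_mul_distrib, ← Finset.prod_pow]
    refine Finset.prod_congr rfl fun i _ => ?_
    linear_combination -Real.sin_sq_add_cos_sq (chebAngle q i)
  refine (pow_left_inj₀ ?_ ?_ two_ne_zero).mp hsq
  · exact Finset.prod_nonneg fun i _ => by linarith [Real.neg_one_le_cos (chebAngle q i)]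
  · exact Finset.prod_nonneg fun i _ => (sin_chebAngle_pos q i i.2).le

/-! ### The rescaled Chebyshev polynomial and its derivative at the nodes. -/

theorem chebNode_injective (q : ℕ) :
    Function.Injective fun i : Fin q => 2 * Real.cos (chebAngle q i) := by
  intro i j h
  have hq : (q : ℝ) ≠ 0 := by exact_mod_cast (by have := i.2; omega : q ≠ 0)
  have h1 : Real.cos (chebAngle q i) = Real.cos (chebAngle q j) := by simpa using h
  have h2 := Real.injOn_cos ⟨(chebAngle_pos q i i.2).le, (chebAngle_lt_pi q i i.2).le⟩
    ⟨(chebAngle_pos q j j.2).le, (chebAngle_lt_pi q j j.2).le⟩ h1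
  unfold chebAngle at h2
  rw [mul_left_inj' Real.pi_ne_zero, div_left_inj' (by simpa using hq)] at h2
  have h3 : ((i : ℕ) : ℝ) = (j : ℕ) := by linarith
  exact Fin.ext (by exact_mod_cast h3)

open Polynomial in
theorem chebyshev_C_monic_natDegree (q : ℕ) (hq : 0 < q) :
    (Chebyshev.C ℝ q).Monic ∧ (Chebyshev.C ℝ q).natDegree = q := by
  have h := Chebyshev.C_comp_two_mul_X ℝ q
  have h2X : (2 * X : ℝ[X]) = Polynomial.C 2 * X := by
    rw [map_ofNat]
  have hdeg : (2 * X : ℝ[X]).natDegree = 1 := by rw [h2X]; exact natDegree_C_mul_X 2 two_ne_zero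
  have h2T : (2 * Chebyshev.T ℝ q : ℝ[X]) = Polynomial.C 2 * Chebyshev.T ℝ q := by
    rw [map_ofNat]
  have h1 := congrArg natDegree h
  rw [natDegree_comp, hdeg, mul_one, h2T, natDegree_C_mul two_ne_zero,
    Chebyshev.natDegree_T, Int.natAbs_natCast] at h1
  refine ⟨?_, h1⟩
  have h3 := congrArg leadingCoeff h
  rw [leadingCoeff_comp (by rw [hdeg]; exact one_ne_zero), h1, h2T, h2X] at h3
  simp only [leadingCoeff_mul, leadingCoeff_C, Chebyshev.leadingCoeff_T, Int.natAbs_natCast,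
    leadingCoeff_X, mul_one] at h3
  have h4 : (2 : ℝ) * 2 ^ (q - 1) = 2 ^ q := by
    rw [← pow_succ', Nat.sub_add_cancel hq]
  have h5 : (2 : ℝ) ^ q ≠ 0 := by positivity
  rw [Monic]
  refine mul_right_cancel₀ h5 ?_
  rw [h3, one_mul, ← h4]

open Polynomial in
theorem chebyshev_C_eq_nodal (q : ℕ) (hq : 0 < q) :
    Chebyshev.C ℝ q =
      Lagrange.nodal Finset.univ (fun i : Fin q => 2 * Real.cos (chebAngle q i)) := by
  obtain ⟨hm, hd⟩ := chebyshev_C_monic_natDegree q hq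
  have hne : Chebyshev.C ℝ q ≠ 0 := hm.ne_zero
  have hdeg : (Chebyshev.C ℝ q).degree = (Finset.univ : Finset (Fin q)).card := by
    rw [degree_eq_natDegree hne, hd, Finset.card_univ, Fintype.card_fin]
  refine eq_of_degree_le_of_eval_index_eq (v := fun i : Fin q => 2 * Real.cos (chebAngle q i))
    Finset.univ (chebNode_injective q).injOn hdeg.le ?_ ?_ ?_
  · rw [hdeg, Lagrange.degree_nodal]
  · rw [hm.leadingCoeff, Lagrange.nodal_monic.leadingCoeff]
  · intro i _
    refine Eq.trans ?_ (Lagrange.eval_nodal_at_node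
      (v := fun i : Fin q => 2 * Real.cos (chebAngle q i)) (Finset.mem_univ i)).symm
    rw [Chebyshev.C_two_mul_real_cos, Int.cast_natCast, cos_mul_chebAngle q i i.2, mul_zero]

open Polynomial in
theorem derivative_chebyshev_C_eval (q : ℕ) (θ : ℝ) :
    (derivative (Chebyshev.C ℝ q)).eval (2 * Real.cos θ) * Real.sin θ = q * Real.sin (q * θ) := by
  have h := congrArg derivative (Chebyshev.C_comp_two_mul_X ℝ q)
  rw [derivative_comp] at h
  have h1 := congrArg (Polynomial.eval (Real.cos θ)) h
  have h2 := Chebyshev.U_real_cos θ ((q : ℤ) - 1)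
  simp [Chebyshev.T_derivative_eq_U] at h1
  push_cast at h2
  rw [sub_add_cancel] at h2
  rw [h1, mul_assoc, h2]

/-- At a node the derivative is `q (-1)^i / sin ψ`; the factors `q` cancel against the weights, the
sines against `∏ (1 + cos ψ)`, and only signs remain. -/
theorem prod_weight_mul_derivative (q : ℕ) (hq : 0 < q) :
    ∏ i : Fin q, ((1 + Real.cos (chebAngle q i)) / q *
      (Polynomial.derivative (Polynomial.Chebyshev.C ℝ q)).eval (2 * Real.cos (chebAngle q i))) =
      (-1) ^ (q * (q - 1) / 2) := by
  have hq' : (q : ℝ) ≠ 0 := by exact_mod_cast hq.ne'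
  have h : ∀ i : Fin q, (1 + Real.cos (chebAngle q i)) / q *
      (Polynomial.derivative (Polynomial.Chebyshev.C ℝ q)).eval (2 * Real.cos (chebAngle q i)) =
      (1 + Real.cos (chebAngle q i)) * (-1) ^ (i : ℕ) / Real.sin (chebAngle q i) := by
    intro i
    have hs := (sin_chebAngle_pos q i i.2).ne'
    have h1 := derivative_chebyshev_C_eval q (chebAngle q i)
    rw [sin_mul_chebAngle q i i.2] at h1
    rw [eq_div_iff hs, mul_assoc, h1]
    field_simp
  have hs : ∏ i : Fin q, Real.sin (chebAngle q i) ≠ 0 :=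
    (Finset.prod_pos fun (i : Fin q) _ => sin_chebAngle_pos q i i.2).ne'
  rw [Finset.prod_congr rfl fun i _ => h i, Finset.prod_div_distrib, Finset.prod_mul_distrib,
    prod_one_add_cos_chebAngle, mul_div_cancel_left₀ _ hs, Finset.prod_pow_eq_pow_sum,
    Fin.sum_univ_eq_sum_range (fun i => i), Finset.sum_range_id]

/-! ### Hankel determinants at negative indices for the two families of strips. -/

theorem neg_one_pow_two_mul_choose (k : ℕ) : (-1 : ℝ) ^ (2 * k * (2 * k - 1) / 2) = (-1) ^ k := by
  rw [Nat.mul_assoc, Nat.mul_div_cancel_left _ two_pos, Nat.mul_comm, pow_mul]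
  rcases Nat.eq_zero_or_pos k with rfl | hk
  · simp
  · rw [Odd.neg_one_pow ⟨k - 1, by omega⟩]

theorem neg_one_zpow_congr {a b : ℤ} (h : Even (a - b)) : (-1 : ℝ) ^ a = (-1) ^ b := by
  rw [← sub_add_cancel a b, zpow_add₀ (by norm_num), h.neg_one_zpow, one_mul]

theorem ratCast_det {d : ℕ} (M : Matrix (Fin d) (Fin d) ℚ) :
    ((M.det : ℚ) : ℝ) = (of fun i j => (M i j : ℝ)).det :=
  (algebraMap ℚ ℝ).map_det M

theorem prod_chebNode_even (k : ℕ) (hk : 0 < k) :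
    ∏ i : Fin (2 * k), (2 * Real.cos (chebAngle (2 * k) i)) = 2 * (-1) ^ k := by
  have h := congrArg (Polynomial.eval 0) (chebyshev_C_eq_nodal (2 * k) (by omega))
  rw [Lagrange.eval_nodal] at h
  have h0 := Polynomial.Chebyshev.C_two_mul_real_cos (Real.pi / 2) ((2 * k : ℕ) : ℤ)
  rw [Real.cos_pi_div_two, mul_zero, h] at h0
  have e : (((2 * k : ℕ) : ℤ) : ℝ) * (Real.pi / 2) = k * Real.pi := by push_cast; ring
  rw [e, Real.cos_nat_mul_pi] at h0
  rw [← h0]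
  simp only [zero_sub]
  rw [Finset.prod_neg, Finset.card_univ, Fintype.card_fin, pow_mul]
  simp

open Polynomial in
/-- Negative indices for strips of height `4k - 2`. -/
theorem pathSum_negative_hankel (k : ℕ) (hk : 1 ≤ k) :
    (∃! b : ℤ → ℚ, IsRecurrenceExtension (fun m => (pathSum m (4 * k - 2) : ℚ)) b) ∧
      ∀ b : ℤ → ℚ, IsRecurrenceExtension (fun m => (pathSum m (4 * k - 2) : ℚ)) b → ∀ n : ℕ,
        (Matrix.of fun i j : Fin (2 * k) => b (-(n : ℤ) - (i : ℕ) - (j : ℕ))).det =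
          (-1 : ℚ) ^ (k * n) * (2 : ℚ) ^ (-(n : ℤ) - 4 * (k : ℤ) + 2) := by
  have hprod := prod_chebNode_even k hk
  have hx : ∀ l : Fin (2 * k), 2 * Real.cos (chebAngle (2 * k) l) ≠ 0 := by
    intro l
    have hne : ∏ i : Fin (2 * k), (2 * Real.cos (chebAngle (2 * k) i)) ≠ 0 := by
      rw [hprod]
      simp
    exact Finset.prod_ne_zero_iff.mp hne l (Finset.mem_univ l)
  have hnodal := chebyshev_C_eq_nodal (2 * k) (by omega)
  obtain ⟨h1, h2⟩ := exponential_sum_extension (fun l : Fin (2 * k) =>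
    2 * Real.cos (chebAngle (2 * k) l)) (fun l => (1 + Real.cos (chebAngle (2 * k) l)) / (2 * k : ℕ)) hx
    (Chebyshev.C ℚ (2 * k : ℕ)) (by rw [Chebyshev.map_C, hnodal])
    (fun m => (pathSum m (4 * k - 2) : ℚ))
    (fun m => by
      rw [← pathSum_eq (2 * k) m (by omega), show 2 * (2 * k) - 2 = 4 * k - 2 by omega]
      norm_cast)
  refine ⟨h1, fun b hb n => ?_⟩
  have hw := prod_weight_mul_derivative (2 * k) (by omega)
  rw [Finset.prod_mul_distrib, hnodal, det_vandermonde_sq, neg_one_pow_two_mul_choose] at hw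
  have hw' : (∏ l : Fin (2 * k), (1 + Real.cos (chebAngle (2 * k) l)) / (2 * k : ℕ)) *
      (vandermonde fun l : Fin (2 * k) => 2 * Real.cos (chebAngle (2 * k) l)).det ^ 2 = 1 := by
    refine mul_left_cancel₀ (pow_ne_zero k (neg_ne_zero.mpr (one_ne_zero (α := ℝ)))) ?_
    rw [mul_one]
    linear_combination hw
  apply Rat.cast_injective (α := ℝ)
  rw [ratCast_det]
  simp only [of_apply, h2 b hb]
  rw [det_hankel_exponential_sum _ _ hx, hprod, mul_right_comm, hw', one_mul]
  push_cast
  rw [mul_zpow, mul_comm]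
  congr 1
  · rw [← zpow_natCast, ← zpow_natCast, ← _root_.zpow_mul]
    refine neg_one_zpow_congr ⟨-(k * n) - k * (2 * k - 1), ?_⟩
    push_cast
    ring
  · congr 1
    ring

theorem chebAngle_mid (k : ℕ) : chebAngle (2 * k + 1) k = Real.pi / 2 := by
  unfold chebAngle
  push_cast
  field_simp

/-- The nodes `2 cos ψ` for strips of height `4k` without the node zero. -/
noncomputable def oddNode (k : ℕ) (l : Fin (2 * k)) : ℝ :=
  2 * Real.cos (chebAngle (2 * k + 1) ((⟨k, by omega⟩ : Fin (2 * k + 1)).succAbove l : ℕ))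

/-- The weights that belong to `oddNode`. -/
noncomputable def oddWeight (k : ℕ) (l : Fin (2 * k)) : ℝ :=
  (1 + Real.cos (chebAngle (2 * k + 1) ((⟨k, by omega⟩ : Fin (2 * k + 1)).succAbove l : ℕ))) /
    (2 * k + 1 : ℕ)

theorem chebyshev_C_odd_eq (k : ℕ) :
    Polynomial.Chebyshev.C ℝ (2 * k + 1 : ℕ) =
      Polynomial.X * Lagrange.nodal Finset.univ (oddNode k) := by
  rw [chebyshev_C_eq_nodal (2 * k + 1) (by omega), Lagrange.nodal,
    Fin.prod_univ_succAbove _ ⟨k, by omega⟩, Lagrange.nodal]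
  simp only [chebAngle_mid, Real.cos_pi_div_two, mul_zero, map_zero, sub_zero]
  rfl

theorem derivative_chebyshev_C_odd_eval_zero (k : ℕ) :
    (Polynomial.derivative (Polynomial.Chebyshev.C ℝ (2 * k + 1 : ℕ))).eval 0 =
      (2 * k + 1 : ℕ) * (-1) ^ k := by
  have h := derivative_chebyshev_C_eval (2 * k + 1) (chebAngle (2 * k + 1) k)
  rw [sin_mul_chebAngle _ _ (by omega), chebAngle_mid, Real.cos_pi_div_two, Real.sin_pi_div_two,
    mul_zero, mul_one] at h
  exact h

/-- With the root zero split off, the product of the remaining roots is the derivative of the full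
polynomial at zero; there is no sign since their number is even. -/
theorem prod_oddNode (k : ℕ) : ∏ l, oddNode k l = (2 * k + 1 : ℕ) * (-1) ^ k := by
  rw [← derivative_chebyshev_C_odd_eval_zero, chebyshev_C_odd_eq, Polynomial.derivative_mul]
  simp only [Polynomial.derivative_X, one_mul, Polynomial.eval_add, Polynomial.eval_mul,
    Polynomial.eval_X, zero_mul, add_zero, Lagrange.eval_nodal, zero_sub]
  rw [Finset.prod_neg, Finset.card_univ, Fintype.card_fin, pow_mul]
  simp

theorem oddNode_ne_zero (k : ℕ) (l : Fin (2 * k)) : oddNode k l ≠ 0 := by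
  have hne : ∏ l, oddNode k l ≠ 0 := by
    rw [prod_oddNode]
    have : ((2 * k + 1 : ℕ) : ℝ) ≠ 0 := by positivity
    simpa using this
  exact Finset.prod_ne_zero_iff.mp hne l (Finset.mem_univ l)

theorem prod_oddWeight_mul (k : ℕ) :
    (∏ l, oddWeight k l) * (vandermonde (oddNode k)).det ^ 2 = ((2 * k + 1 : ℕ) : ℝ)⁻¹ := by
  have hq : ((2 * k + 1 : ℕ) : ℝ) ≠ 0 := by positivity
  have h := prod_weight_mul_derivative (2 * k + 1) (by omega)
  rw [Fin.prod_univ_succAbove _ ⟨k, by omega⟩] at h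
  simp only [chebAngle_mid, Real.cos_pi_div_two, mul_zero, add_zero,
    derivative_chebyshev_C_odd_eval_zero, Finset.prod_mul_distrib] at h
  have hw : (∏ l : Fin (2 * k), (1 + Real.cos (chebAngle (2 * k + 1)
      ((⟨k, by omega⟩ : Fin (2 * k + 1)).succAbove l : ℕ))) / ((2 * k + 1 : ℕ) : ℝ)) =
      ∏ l, oddWeight k l := rfl
  -- At a non-zero node the derivative of `X * nodal` is the node times the derivative of `nodal`,
  -- hence the extra factor `∏ oddNode`.
  have hd : (∏ l : Fin (2 * k), (Polynomial.derivative
      (Polynomial.Chebyshev.C ℝ (2 * k + 1 : ℕ))).eval (2 * Real.cos (chebAngle (2 * k + 1)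
      ((⟨k, by omega⟩ : Fin (2 * k + 1)).succAbove l : ℕ)))) =
      ((2 * k + 1 : ℕ) * (-1) ^ k) * ((-1) ^ k * (vandermonde (oddNode k)).det ^ 2) := by
    rw [← prod_oddNode, ← neg_one_pow_two_mul_choose, ← det_vandermonde_sq,
      ← Finset.prod_mul_distrib]
    refine Finset.prod_congr rfl fun l _ => ?_
    rw [chebyshev_C_odd_eq, Polynomial.derivative_mul]
    change Polynomial.eval (oddNode k l) _ = _
    simp only [Polynomial.derivative_X, one_mul, Polynomial.eval_add, Polynomial.eval_mul,
      Polynomial.eval_X, Lagrange.eval_nodal_at_node (Finset.mem_univ l), zero_add]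
  rw [hw, hd] at h
  have hsign : (-1 : ℝ) ^ ((2 * k + 1) * (2 * k + 1 - 1) / 2) = (-1) ^ k := by
    rw [Nat.add_sub_cancel, mul_left_comm, Nat.mul_div_cancel_left _ two_pos, pow_mul,
      Odd.neg_one_pow ⟨k, rfl⟩]
  rw [hsign] at h
  have hs : ((-1 : ℝ) ^ k) * (-1) ^ k = 1 := by rw [← mul_pow]; simp
  have h3 : (1 : ℝ) / (2 * k + 1 : ℕ) * (2 * k + 1 : ℕ) = 1 := div_mul_cancel₀ _ hq
  refine eq_inv_of_mul_eq_one_left ?_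
  generalize (1 : ℝ) / (2 * k + 1 : ℕ) = N' at *
  generalize ((2 * k + 1 : ℕ) : ℝ) = N at *
  generalize (-1 : ℝ) ^ k = e at *
  generalize (∏ l, oddWeight k l) = A at *
  generalize (vandermonde (oddNode k)).det ^ 2 = V at *
  linear_combination e * h - e ^ 4 * A * N * V * h3 + (1 - A * V * N * (1 + e ^ 2)) * hs

open Polynomial in
/-- Negative indices for strips of height `4k`. -/
theorem pathSumMod_negative_hankel (k : ℕ) :
    (∃! b : ℤ → ℚ, IsRecurrenceExtension (pathSumMod k) b) ∧
      ∀ b : ℤ → ℚ, IsRecurrenceExtension (pathSumMod k) b → ∀ n : ℕ,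
        (Matrix.of fun i j : Fin (2 * k) => b (-(n : ℤ) - (i : ℕ) - (j : ℕ) - 1)).det =
          (-1 : ℚ) ^ ((k : ℤ) * ((n : ℤ) - 1)) *
            (2 * (k : ℚ) + 1) ^ (-(n : ℤ) - 4 * (k : ℤ)) := by
  have hq : ((2 * k + 1 : ℕ) : ℝ) ≠ 0 := by positivity
  -- Division by `X` removes the root zero, leaving a rational polynomial with non-zero constant
  -- term.
  have hmap : ((Chebyshev.C ℚ (2 * k + 1 : ℕ)).divX).map (algebraMap ℚ ℝ) =
      Lagrange.nodal Finset.univ (oddNode k) := by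
    refine mul_left_cancel₀ X_ne_zero ?_
    rw [← chebyshev_C_odd_eq, ← Chebyshev.map_C (algebraMap ℚ ℝ)]
    have h0 : (Chebyshev.C ℚ (2 * k + 1 : ℕ)).coeff 0 = 0 := by
      have h1 := congrArg (Polynomial.eval 0) (chebyshev_C_odd_eq k)
      rw [eval_mul, eval_X, zero_mul, ← coeff_zero_eq_eval_zero,
        ← Chebyshev.map_C (algebraMap ℚ ℝ), coeff_map] at h1
      simpa using h1
    conv_rhs => rw [← X_mul_divX_add (Chebyshev.C ℚ (2 * k + 1 : ℕ)), h0]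
    simp
  have hsum : ∀ n : ℕ, (pathSumMod k n : ℝ) = ∑ l, oddWeight k l * oddNode k l ^ n := by
    intro n
    have h := pathSum_eq (2 * k + 1) n (by omega)
    rw [Fin.sum_univ_succAbove _ ⟨k, by omega⟩] at h
    simp only [chebAngle_mid, Real.cos_pi_div_two, mul_zero, add_zero] at h
    rw [show 2 * (2 * k + 1) - 2 = 4 * k by omega] at h
    have h' : (pathSum n (4 * k) : ℝ) =
        1 / (2 * k + 1 : ℕ) * 0 ^ n + ∑ l, oddWeight k l * oddNode k l ^ n := h
    rw [pathSumMod]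
    -- The zero node contributes `0 ^ n / (2k+1)`, which matters only for `n = 0`: there the count
    -- `1` drops to `1 - 1/(2k+1) = 2k/(2k+1)`.
    split_ifs with hn
    · subst hn
      have hone : pathSum 0 (4 * k) = 1 := by
        rw [pathSum, Finset.sum_congr rfl fun s _ => pathNum_zero (4 * k) 0 s (by omega),
          Finset.sum_ite_eq, if_pos (by simp)]
      rw [hone, pow_zero, Nat.cast_one, mul_one] at h'
      have h2 : ∑ l, oddWeight k l * oddNode k l ^ 0 = 1 - 1 / (2 * k + 1 : ℕ) := by linarith
      rw [h2]
      push_cast at hq ⊢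
      field_simp
      ring
    · rw [zero_pow hn, mul_zero, zero_add] at h'
      exact_mod_cast h'
  obtain ⟨h1, h2⟩ := exponential_sum_extension (oddNode k) (oddWeight k) (oddNode_ne_zero k)
    _ hmap (pathSumMod k) hsum
  refine ⟨h1, fun b hb n => ?_⟩
  apply Rat.cast_injective (α := ℝ)
  rw [ratCast_det]
  have hidx : ∀ i j : ℕ, -(n : ℤ) - i - j - 1 = -((n + 1 : ℕ) : ℤ) - i - j := by
    intro i j
    push_cast
    ring
  simp only [of_apply, h2 b hb, hidx]
  rw [det_hankel_exponential_sum _ _ (oddNode_ne_zero k), prod_oddNode, mul_right_comm,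
    prod_oddWeight_mul, mul_zpow, ← mul_assoc, ← _root_.zpow_neg_one, ← zpow_add₀ hq,
    mul_comm]
  push_cast
  congr 1
  · rw [← zpow_natCast, ← _root_.zpow_mul]
    refine neg_one_zpow_congr ⟨-(k * n) - k * (2 * k - 1), ?_⟩
    ring
  · congr 1
    ring

end

/-! ### Combining the signs and returning to one-based indices. -/

theorem floorSign_mul (k c d : ℕ) :
    floorSign k c * floorSign k d =
      if Nat.gcd c (2 * k + 1) = 1 ∧ Nat.gcd d (2 * k + 1) = 1 then
        (-1) ^ (∑ i ∈ Finset.Icc 1 k, (i * c / (2 * k + 1) + i * d / (2 * k + 1))) else 0 := by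
  unfold floorSign
  rw [Finset.sum_add_distrib, pow_add]
  simp only [Nat.Coprime]
  split_ifs <;> first | tauto | simp

theorem signed_floorSign_mul (k r s c d : ℕ) :
    (-1) ^ (k * (r + s)) * (floorSign k c * floorSign k d) =
      if Nat.gcd c (2 * k + 1) = 1 ∧ Nat.gcd d (2 * k + 1) = 1 then
        (-1) ^ (k * (r + 1 + (s + 1)) +
          ∑ i ∈ Finset.Icc 1 k, (i * c / (2 * k + 1) + i * d / (2 * k + 1))) else 0 := by
  rw [floorSign_mul, mul_ite, mul_zero, pow_add,
    show k * (r + 1 + (s + 1)) = k * (r + s) + 2 * k by ring, pow_add _ (k * (r + s)), pow_mul _ 2]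
  simp

theorem intCast_det {d : ℕ} (M : Matrix (Fin d) (Fin d) ℤ) :
    ((M.det : ℤ) : ℝ) = (Matrix.of fun i j => (M i j : ℝ)).det :=
  (Int.castRingHom ℝ).map_det M

theorem corollary60 :
    -- Hankel determinants of numbers of sequences of odd length
    (∀ n k r s : ℕ, 1 ≤ r → r ≤ k → 1 ≤ s → s ≤ k →
      (Matrix.of fun i j : Fin k =>
          (altNum k (2 * n + 2 * (i : ℕ) + 2 * (j : ℕ) + 1) r s : ℤ)).det =
        if Nat.gcd (2 * r - 1) (2 * k + 1) = 1 ∧ Nat.gcd (2 * s - 1) (2 * k + 1) = 1 then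
          (-1 : ℤ) ^ (k * (r + s) + ∑ i ∈ Finset.Icc 1 k,
            (i * (2 * r - 1) / (2 * k + 1) + i * (2 * s - 1) / (2 * k + 1)))
        else 0) ∧
    -- Hankel determinants of numbers of sequences of even positive length
    (∀ n k r s : ℕ, 1 ≤ n → 1 ≤ r → r ≤ k → 1 ≤ s → s ≤ k →
      (Matrix.of fun i j : Fin k =>
          (altNum k (2 * n + 2 * (i : ℕ) + 2 * (j : ℕ)) r s : ℤ)).det =
        if Nat.gcd (2 * r - 1) (2 * k + 1) = 1 ∧ Nat.gcd (2 * s) (2 * k + 1) = 1 then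
          (-1 : ℤ) ^ (k * (r + s) + ∑ i ∈ Finset.Icc 1 k,
            (i * (2 * r - 1) / (2 * k + 1) + 2 * i * s / (2 * k + 1)))
        else 0) ∧
    -- the even case with `n = 0`, where the number for length `0` is the value that is
    -- obtained by extending the sequence of the numbers for the lengths `2, 4, 6, …`
    (∀ k r s : ℕ, 1 ≤ r → r ≤ k → 1 ≤ s → s ≤ k →
      (∃! b : ℤ → ℚ, IsRecurrenceExtension (fun m => (altNum k (2 * m + 2) r s : ℚ)) b) ∧
      ∀ b : ℤ → ℚ, IsRecurrenceExtension (fun m => (altNum k (2 * m + 2) r s : ℚ)) b →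
        (Matrix.of fun i j : Fin k => b ((i : ℕ) + (j : ℕ) - 1)).det =
          if Nat.gcd (2 * r - 1) (2 * k + 1) = 1 ∧ Nat.gcd (2 * s) (2 * k + 1) = 1 then
            (-1 : ℚ) ^ (k * (r + s) + ∑ i ∈ Finset.Icc 1 k,
              (i * (2 * r - 1) / (2 * k + 1) + 2 * i * s / (2 * k + 1)))
          else 0) ∧
    -- negative indices, strips of height `4k`
    (∀ k : ℕ, 1 ≤ k →
      (∃! b : ℤ → ℚ, IsRecurrenceExtension (pathSumMod k) b) ∧
      ∀ b : ℤ → ℚ, IsRecurrenceExtension (pathSumMod k) b → ∀ n : ℕ,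
        (Matrix.of fun i j : Fin (2 * k) => b (-(n : ℤ) - (i : ℕ) - (j : ℕ) - 1)).det =
          (-1 : ℚ) ^ ((k : ℤ) * ((n : ℤ) - 1)) *
            (2 * (k : ℚ) + 1) ^ (-(n : ℤ) - 4 * (k : ℤ))) ∧
    -- negative indices, strips of height `4k - 2`
    (∀ k : ℕ, 1 ≤ k →
      (∃! b : ℤ → ℚ, IsRecurrenceExtension (fun m => (pathSum m (4 * k - 2) : ℚ)) b) ∧
      ∀ b : ℤ → ℚ, IsRecurrenceExtension (fun m => (pathSum m (4 * k - 2) : ℚ)) b → ∀ n : ℕ,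
        (Matrix.of fun i j : Fin (2 * k) => b (-(n : ℤ) - (i : ℕ) - (j : ℕ))).det =
          (-1 : ℚ) ^ (k * n) * (2 : ℚ) ^ (-(n : ℤ) - 4 * (k : ℤ) + 2)) := by
  have hcomm : ∀ i s : ℕ, 2 * i * s = i * (2 * s) := fun i s => by ring
  simp only [hcomm]
  refine ⟨?_, ?_, ?_, fun k _ => pathSumMod_negative_hankel k, pathSum_negative_hankel⟩
  · intro n k r s hr hrk hs hsk
    obtain ⟨r, rfl⟩ : ∃ t, r = t + 1 := ⟨r - 1, by omega⟩
    obtain ⟨s, rfl⟩ : ∃ t, s = t + 1 := ⟨s - 1, by omega⟩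
    apply Int.cast_injective (α := ℝ)
    rw [intCast_det, show 2 * (r + 1) - 1 = 2 * r + 1 by omega,
      show 2 * (s + 1) - 1 = 2 * s + 1 by omega]
    push_cast
    rw [← signed_floorSign_mul]
    refine Eq.trans ?_ (det_hankel_stepMatrix_pow k n ⟨r, hrk⟩ ⟨s, hsk⟩)
    congr 1
    ext i j
    simp only [Matrix.of_apply]
    rw [← (altNum_eq_stepMatrix_pow k (n + i + j) ⟨r, hrk⟩ ⟨s, hsk⟩).1, mul_add, mul_add]
    norm_cast
  · intro n k r s hn hr hrk hs hsk
    obtain ⟨n, rfl⟩ : ∃ t, n = t + 1 := ⟨n - 1, by omega⟩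
    obtain ⟨r, rfl⟩ : ∃ t, r = t + 1 := ⟨r - 1, by omega⟩
    obtain ⟨s, rfl⟩ : ∃ t, s = t + 1 := ⟨s - 1, by omega⟩
    apply Int.cast_injective (α := ℝ)
    rw [intCast_det, show 2 * (r + 1) - 1 = 2 * r + 1 by omega,
      show 2 * (s + 1) = 2 * s + 2 by omega]
    push_cast
    rw [← signed_floorSign_mul]
    refine Eq.trans ?_ (det_hankel_stepMatrix_pow_mul k (n + 1) ⟨r, hrk⟩ ⟨s, hsk⟩)
    congr 1
    ext i j
    simp only [Matrix.of_apply]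
    have h := altNum_even_eq k (n + i + j) ⟨r, hrk⟩ ⟨s, hsk⟩
    rw [show n + 1 + (i : ℕ) + j = n + i + j + 1 by ring, ← h,
      show 2 * (n + 1) + 2 * (i : ℕ) + 2 * j = 2 * (n + i + j) + 2 by ring]
    norm_cast
  · intro k r s hr hrk hs hsk
    obtain ⟨r, rfl⟩ : ∃ t, r = t + 1 := ⟨r - 1, by omega⟩
    obtain ⟨s, rfl⟩ : ∃ t, s = t + 1 := ⟨s - 1, by omega⟩
    obtain ⟨h1, h2⟩ := altNum_even_extension k ⟨r, hrk⟩ ⟨s, hsk⟩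
    refine ⟨h1, fun b hb => ?_⟩
    apply Rat.cast_injective (α := ℝ)
    rw [ratCast_det, show 2 * (r + 1) - 1 = 2 * r + 1 by omega,
      show 2 * (s + 1) = 2 * s + 2 by omega]
    refine Eq.trans (Eq.trans ?_ (det_hankel_stepMatrix_pow_mul k 0 ⟨r, hrk⟩ ⟨s, hsk⟩))
      ((signed_floorSign_mul k r s _ _).trans ?_)
    · congr 1
      ext i j
      simp only [Matrix.of_apply]
      rw [zero_add, ← h2 b hb (i + j), Nat.cast_add]
    · split_ifs <;> simp
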